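/- Let $S$ be a non-empty compact metric space and let $C(S)$ be the space of continuous functions $S\to\mathbb{R}$ with the sup-norm and its Borel $\sigma$-algebra; operations and inequalities between functions are pointwise (so $f>g$ means $f(s)>g(s)$ for all $s\in S$). A *standard max-stable process* is a process $\eta=(\eta_s)_{s\in S}$ with sample paths in $C(S)$ and margins $P(\eta_s\le x)=e^x$ for $x\le 0$, $s\in S$, such that for every $n\ge1$ there are $a_n,b_n\in C(S)$, $a_n>0$, for which $\max_{1\le i\le n}(\eta^{(i)}-b_n)/a_n$ has the law of $\eta$, where $\eta^{(1)},\dots,\eta^{(n)}$ are independent copies of $\eta$. Its $D$-norm is the function $\|f\|_D=E\big(\sup_{s\in S}|f(s)|Z_s\big)$ for which $P(\eta\le f)=\exp(-\|f\|_D)$ for every bounded $f:S\to(-\infty,0]$ with only finitely many discontinuities; here $Z=(Z_s)_{s\in S}$, a *generator* of $\|\cdot\|_D$, is a process with sample paths in $C(S)$, $Z\ge0$, $E(Z_s)=1$ for all $s\in S$ and $E(\sup_{s\in S} Z_s)<\infty$. The *dual $D$-norm function* is $\vert\!\vert\!\vert f\vert\!\vert\!\vert_D=E\big(\inf_{s\in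 S}|f(s)|Z_s\big)$, and in $E(\vert\!\vert\!\vert \eta\vert\!\vert\!\vert_D)$ it is evaluated at the sample paths of $\eta$. A *copula process* is a process with sample paths in $C(S)$ all of whose univariate margins are uniformly distributed on $(0,1)$. **Theorem.** Let $U^{(1)},U^{(2)},\dots$ be independent copies of a copula process $U$ that lies in the max-domain of attraction of a standard max-stable process $\eta$, that is, there are $c_n,d_n\in C(S)$, $c_n>0$, such that $\max_{1\le i\le n}(U^{(i)}-d_n)/c_n\to\eta$ in distribution in $C(S)$. Let $Z$ be any generator of the $D$-norm $\|\cdot\|_D$ of $\eta$, and let $$\bar\pi_n(U)=P\Big(U^{(n)}>\max_{1\le i<n}U^{(i)}\Big)$$ be the probability that $U^{(n)}$ is a complete record ($\bar\pi_1(U)=1$). Then, for every $n\ge1$, $$P\Big(\bigcup_{k=1}^n\Big\{U^{(k)}>\max_{1\le j\le n,\ j\ne k}U^{(j)}\Big\}\Big)=n\,\bar\pi_n(U),$$ the expectation $E(\vert\!\vert\!\vert \eta\vert\!\vert\!\vert_D)$ is finite, and as $n\to\infty$ $$n\,\bar\pi_n(U)\longrightarrow E\big(\vert\!\vert\!\vert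 \eta\vert\!\vert\!\vert_D\big)\quad\text{and}\quad P\Big(\max_{1\le i\le n}U^{(i)}=U^{(k)}\text{ for some }k\in\{1,\dots,n\}\Big)\longrightarrow E\big(\vert\!\vert\!\vert \eta\vert\!\vert\!\vert_D\big).$$ -/

import Mathlib

open MeasureTheory ProbabilityTheory Filter Topology

/-- `(f - d) / c`, pointwise, for `c, d, f ∈ C(S)` with `c > 0`. -/
noncomputable def standardize {S : Type*} [TopologicalSpace S] (c d : C(S, ℝ))
    (hc : ∀ s, 0 < c s) (f : C(S, ℝ)) : C(S, ℝ) where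
  toFun s := (f s - d s) / c s
  continuous_toFun :=
    (f.continuous.sub d.continuous).div c.continuous (fun s => (hc s).ne')

/-- The pointwise maximum of the first `n + 1` members `x 0, …, x n` of a sequence in `C(S)`. -/
noncomputable def maxFirst {S : Type*} [TopologicalSpace S] (x : ℕ → C(S, ℝ)) (n : ℕ) :
    C(S, ℝ) :=
  (Finset.range (n + 1)).sup' Finset.nonempty_range_add_one x

/-- `X 0, X 1, …` are independent copies of the process `X₀` (processes with sample paths in
`C(S)` are random elements of the Borel space `C(S)`). -/
def IsIIDCopies {S Ω Ω₀ : Type*} [TopologicalSpace S] [MeasurableSpace C(S, ℝ)]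
    [MeasurableSpace Ω] [MeasurableSpace Ω₀]
    (X : ℕ → Ω → C(S, ℝ)) (P : Measure Ω) (X₀ : Ω₀ → C(S, ℝ)) (P₀ : Measure Ω₀) : Prop :=
  iIndepFun X P ∧ ∀ i, IdentDistrib (X i) X₀ P P₀

/-- A max-stable process: it has non-degenerate univariate margins, and for every number
`n + 1 ≥ 1` of independent copies (here: the coordinates on a product space) there are norming
functions `a > 0` and `b` for which the maximum of the standardized copies has the law of `η`. -/
structure IsMaxStableProcess {S Ω : Type*} [TopologicalSpace S] [MeasurableSpace C(S, ℝ)]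
    [MeasurableSpace Ω] (η : Ω → C(S, ℝ)) (Q : Measure Ω) : Prop where
  aemeasurable : AEMeasurable η Q
  nondegenerate : ∀ (s : S) (r : ℝ), ¬ ∀ᵐ ω ∂Q, η ω s = r
  maxStable : ∀ n : ℕ, ∃ (a b : C(S, ℝ)) (ha : ∀ s, 0 < a s),
    IdentDistrib
      (fun x : Fin (n + 1) → C(S, ℝ) =>
        Finset.univ.sup' Finset.univ_nonempty (fun i => standardize a b ha (x i)))
      η (Measure.pi fun _ : Fin (n + 1) => Q.map η) Q

/-- A standard max-stable process: all univariate margins are standard negative exponential. -/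
structure IsStandardMaxStableProcess {S Ω : Type*} [TopologicalSpace S]
    [MeasurableSpace C(S, ℝ)] [MeasurableSpace Ω] (η : Ω → C(S, ℝ)) (Q : Measure Ω) : Prop
    extends IsMaxStableProcess η Q where
  margin : ∀ (s : S) (x : ℝ), x ≤ 0 → Q.real {ω | η ω s ≤ x} = Real.exp x

/-- A copula process: continuous sample paths and univariate margins uniform on `(0, 1)`. -/
structure IsCopulaProcess {S Ω : Type*} [TopologicalSpace S] [MeasurableSpace C(S, ℝ)]
    [MeasurableSpace Ω] (U : Ω → C(S, ℝ)) (P : Measure Ω) : Prop where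
  aemeasurable : AEMeasurable U P
  margin : ∀ s : S, pdf.IsUniform (fun ω => U ω s) (Set.Ioo (0 : ℝ) 1) P volume

/-- The process of which `X 0, X 1, …` are independent copies is in the max-domain of attraction
of `η`: for some norming functions `c n > 0` and `d n` in `C(S)`, the maximum of the standardized
`X 0, …, X n` converges to `η` in distribution in `C(S)` with the sup-norm. -/
def InMaxDomainOfAttraction {S Ω Ω' : Type*} [TopologicalSpace S]
    [MeasurableSpace C(S, ℝ)] [BorelSpace C(S, ℝ)] [MeasurableSpace Ω] [MeasurableSpace Ω']
    (X : ℕ → Ω → C(S, ℝ)) (P : Measure Ω) [IsProbabilityMeasure P]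
    (η : Ω' → C(S, ℝ)) (Q : Measure Ω') [IsProbabilityMeasure Q] : Prop :=
  ∃ (c d : ℕ → C(S, ℝ)) (hc : ∀ n s, 0 < c n s),
    TendstoInDistribution
      (fun n ω => maxFirst (fun i => standardize (c n) (d n) (hc n) (X i ω)) n)
      atTop η (fun _ => P) Q

/-- The function space `E(S)`: bounded real functions with only finitely many discontinuities. -/
def functionSpaceE (S : Type*) [TopologicalSpace S] : Set (S → ℝ) :=
  {f | (∃ C : ℝ, ∀ s, |f s| ≤ C) ∧ {s | ¬ ContinuousAt f s}.Finite}

/-- Generators of `D`-norms: processes with continuous sample paths, `Z ≥ 0`, `E (Z_s) = 1` for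
all `s` and `E (sup_s Z_s) < ∞`. -/
structure IsDNormGenerator {S Ω : Type*} [TopologicalSpace S] [MeasurableSpace C(S, ℝ)]
    [MeasurableSpace Ω] (Z : Ω → C(S, ℝ)) (ρ : Measure Ω) : Prop where
  aemeasurable : AEMeasurable Z ρ
  nonneg : ∀ ω s, 0 ≤ Z ω s
  mean : ∀ s : S, ∫ ω, Z ω s ∂ρ = 1
  integrable_sup : Integrable (fun ω => ⨆ s, Z ω s) ρ

/-- The `D`-norm generated by `Z`: `‖f‖_D = E (sup_s |f(s)| Z_s)`. -/
noncomputable def dNorm {S Ω : Type*} [TopologicalSpace S] [MeasurableSpace Ω]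
    (Z : Ω → C(S, ℝ)) (ρ : Measure Ω) (f : S → ℝ) : ℝ :=
  ∫ ω, ⨆ s, |f s| * Z ω s ∂ρ

/-- The dual `D`-norm function of the `D`-norm generated by `Z`: `f ↦ E (inf_s |f(s)| Z_s)`. -/
noncomputable def dualDNorm {S Ω : Type*} [TopologicalSpace S] [MeasurableSpace Ω]
    (Z : Ω → C(S, ℝ)) (ρ : Measure Ω) (f : S → ℝ) : ℝ :=
  ∫ ω, ⨅ s, |f s| * Z ω s ∂ρ

/-- `Z` generates the `D`-norm corresponding to `η`: it is a generator, and
`P(η ≤ f) = exp(-‖f‖_D)` for all `f ≤ 0` in `E(S)`. -/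
def GeneratesDNormOf {S Ω Ω' : Type*} [TopologicalSpace S] [MeasurableSpace C(S, ℝ)]
    [MeasurableSpace Ω] [MeasurableSpace Ω']
    (Z : Ω → C(S, ℝ)) (ρ : Measure Ω) (η : Ω' → C(S, ℝ)) (Q : Measure Ω') : Prop :=
  IsDNormGenerator Z ρ ∧
    ∀ f ∈ functionSpaceE S, (∀ s, f s ≤ 0) →
      Q.real {ω | ∀ s, η ω s ≤ f s} = Real.exp (-dNorm Z ρ f)

/-- The probability that the `(n + 1)`-st observation `X n` is a complete record, that is,
larger than all its predecessors at every point. -/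
noncomputable def completeRecordProb {S Ω : Type*} [TopologicalSpace S] [MeasurableSpace Ω]
    (X : ℕ → Ω → C(S, ℝ)) (P : Measure Ω) (n : ℕ) : ℝ :=
  P.real {ω | ∀ i < n, ∀ s, X i ω s < X n ω s}

/-- The probability that the first `n + 1` observations are sample concurrent: their pointwise
maximum is one of them. -/
noncomputable def sampleConcurrenceProb {S Ω : Type*} [TopologicalSpace S] [MeasurableSpace Ω]
    (X : ℕ → Ω → C(S, ℝ)) (P : Measure Ω) (n : ℕ) : ℝ :=
  P.real {ω | ∃ k ≤ n, maxFirst (fun i => X i ω) n = X k ω}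

/-- The probability that one of the first `n + 1` observations is at every point strictly larger
than all the others. -/
noncomputable def strictConcurrenceProb {S Ω : Type*} [TopologicalSpace S] [MeasurableSpace Ω]
    (X : ℕ → Ω → C(S, ℝ)) (P : Measure Ω) (n : ℕ) : ℝ :=
  P.real {ω | ∃ k ≤ n, ∀ j ≤ n, j ≠ k → ∀ s, X j ω s < X k ω s}

/-! Records are unchanged by pointwise increasing affine maps, so `U` may be replaced by the
standardized array `Y n i`, whose row maxima `M n` converge to `η`. The next entry is independent of
`M n`, so Fubini writes `n` times a record probability as the mean of `n * ν n {y | M n < y}`, where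
`ν n` is the law of one entry. Up to the shift between `n` and `n + 1`, the theorem combines the
limit of this integrand with weak convergence of `M n`.

For continuous `f < 0`, `n * ν n {y | f < y}` tends to `dualDNorm Z ρ f`. On a finite set of points,
logarithms of `P (M n ≤ f)` give the limit for unions, and inclusion-exclusion turns maxima of `|f
t| * Z t` into minima. Passing to all of `S` is monotone for the upper bound; the lower bound needs
control of oscillations of a single entry, inherited from the maximum (`eventually_upcrossing_le`).

A Fatou lemma for weakly convergent laws then bounds the liminf of strict records below by the mean
of `dualDNorm Z ρ η` (`eventually_lt_record`). For the matching upper bound the same lemma is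
applied to the complementary event, exceeding the maximum at a point `s₀` without being a weak
record: its limiting integrand is `|η s₀| - dualDNorm Z ρ η`. Exceeding at `s₀` has scaled
probability at most one, and `|η s₀|` has mean one, so weak records have limsup at most the same
number (`tendsto_record`). Exchangeability places sample concurrence between scaled strict and
scaled weak records. -/

set_option linter.unusedSectionVars false

/-! ### Analytic and measure-theoretic tools -/

/-- If `p n ^ (n + 1) → exp (-a)` then `(n + 1) (1 - p n) → a`. -/
theorem tendsto_mul_one_sub_of_tendsto_pow {p : ℕ → ℝ} {a : ℝ} (hp : ∀ n, 0 ≤ p n)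
    (h : Tendsto (fun n => p n ^ (n + 1)) atTop (𝓝 (Real.exp (-a)))) :
    Tendsto (fun n : ℕ => (n + 1 : ℝ) * (1 - p n)) atTop (𝓝 a) := by
  have hpos : ∀ᶠ n in atTop, 0 < p n := by
    filter_upwards [h.eventually (lt_mem_nhds (Real.exp_pos (-a)))] with n hn
    rcases (hp n).eq_or_lt with h0 | h0
    · rw [← h0, zero_pow n.succ_ne_zero] at hn
      exact absurd hn (lt_irrefl _)
    · exact h0
  have hlog : Tendsto (fun n : ℕ => (n + 1 : ℝ) * -Real.log (p n)) atTop (𝓝 a) := by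
    have h1 := ((Real.continuousAt_log (Real.exp_ne_zero (-a))).tendsto.comp h).neg
    rw [Real.log_exp, neg_neg] at h1
    refine h1.congr fun n => ?_
    simp [Real.log_pow]
  have hinv : Tendsto (fun n : ℕ => 1 / ((n : ℝ) + 1)) atTop (𝓝 0) :=
    tendsto_one_div_add_atTop_nhds_zero_nat
  have hp1 : Tendsto p atTop (𝓝 1) := by
    have h1 := (Real.continuous_exp.tendsto _).comp (hinv.mul hlog).neg
    rw [zero_mul, neg_zero, Real.exp_zero] at h1
    refine h1.congr' ?_
    filter_upwards [hpos] with n hn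
    have : (n : ℝ) + 1 ≠ 0 := by positivity
    simp only [Function.comp]
    rw [show -(1 / ((n : ℝ) + 1) * (((n : ℝ) + 1) * -Real.log (p n))) = Real.log (p n) by
      field_simp, Real.exp_log hn]
  -- The sandwich is `p * (-log p) ≤ 1 - p ≤ -log p`, with `p → 1`.
  have hlow := hp1.mul hlog
  rw [one_mul] at hlow
  refine tendsto_of_tendsto_of_tendsto_of_le_of_le' hlow hlog ?_ ?_
  · filter_upwards [hpos] with n hn
    have h1 := Real.one_sub_inv_le_log_of_pos hn
    have h2 : p n * -Real.log (p n) ≤ 1 - p n := by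
      have := mul_le_mul_of_nonneg_left h1 hn.le
      rw [mul_sub, mul_inv_cancel₀ hn.ne'] at this
      linarith
    calc p n * ((n + 1 : ℝ) * -Real.log (p n)) = (n + 1 : ℝ) * (p n * -Real.log (p n)) := by ring
      _ ≤ _ := by gcongr
  · filter_upwards [hpos] with n hn
    have h1 := Real.log_le_sub_one_of_pos hn
    gcongr
    linarith

/-- Fatou's lemma for varying measures that converge weakly. -/
theorem lintegral_le_liminf_lintegral_of_continuous_convergence {E : Type*} [TopologicalSpace E]
    [MeasurableSpace E] [OpensMeasurableSpace E] {μ : Measure E} {μs : ℕ → Measure E}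
    (hopen : ∀ G, IsOpen G → μ G ≤ liminf (fun n => μs n G) atTop)
    {φ : E → ℝ} {φs : ℕ → E → ℝ} (hφ : Measurable φ) (hφs : ∀ n, Measurable (φs n))
    (hφ0 : ∀ x, 0 ≤ φ x) (hφs0 : ∀ n x, 0 ≤ φs n x)
    (hconv : ∀ᵐ x ∂μ, ∀ t < φ x, ∀ᶠ p : ℕ × E in atTop ×ˢ 𝓝 x, t < φs p.1 p.2) :
    ∫⁻ x, ENNReal.ofReal (φ x) ∂μ
      ≤ liminf (fun n => ∫⁻ x, ENNReal.ofReal (φs n x) ∂μs n) atTop := by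
  -- By the layer-cake formula it suffices to compare superlevel sets. Up to a null set, `{t < φ}`
  -- is covered by the increasing open sets `O m`, each contained in `{t < φs n}` for all `n ≥ m`.
  have key : ∀ t, μ {x | t < φ x} ≤ liminf (fun n => μs n {x | t < φs n x}) atTop := by
    intro t
    let O : ℕ → Set E := fun m => interior {x | ∀ n ≥ m, t < φs n x}
    have hO : Monotone O := fun a b hab =>
      interior_mono fun x hx n hn => hx n (hab.trans hn)
    have h1 : μ {x | t < φ x} ≤ μ (⋃ m, O m) := by
      refine measure_mono_ae ?_
      filter_upwards [hconv] with x hx hxt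
      obtain ⟨pa, hpa, pb, hpb, hp⟩ := eventually_prod_iff.1 (hx t hxt)
      obtain ⟨m, hm⟩ := eventually_atTop.1 hpa
      refine Set.mem_iUnion.2 ⟨m, mem_interior_iff_mem_nhds.2 ?_⟩
      filter_upwards [hpb] with y hy n hn using hp (hm n hn) hy
    refine h1.trans ?_
    rw [hO.measure_iUnion]
    refine iSup_le fun m => (hopen _ isOpen_interior).trans ?_
    refine liminf_le_liminf ?_
    filter_upwards [eventually_ge_atTop m] with n hn
    exact measure_mono fun x hx => interior_subset hx n hn
  rw [lintegral_eq_lintegral_meas_lt μ (.of_forall hφ0) hφ.aemeasurable]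
  calc _ ≤ ∫⁻ t in Set.Ioi 0, liminf (fun n => μs n {x | t < φs n x}) atTop :=
        lintegral_mono fun t => key t
    _ ≤ liminf (fun n => ∫⁻ t in Set.Ioi (0:ℝ), μs n {x | t < φs n x}) atTop := by
        refine lintegral_liminf_le fun n => ?_
        exact Antitone.measurable fun a b hab => measure_mono fun x hx => hab.trans_lt hx
    _ = _ := by
        congr 1 with n
        rw [lintegral_eq_lintegral_meas_lt (μs n) (.of_forall (hφs0 n)) (hφs n).aemeasurable]

/-- Convergence of the (scaled) measures of finite unions implies that of finite intersections. -/
theorem tendsto_measureReal_iInter_of_iUnion {ι : Type*} [DecidableEq ι] {E : ℕ → Type*}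
    [∀ n, MeasurableSpace (E n)] (μ : ∀ n, Measure (E n)) [∀ n, IsFiniteMeasure (μ n)]
    (a : ℕ → ℝ) (A : ∀ n, ι → Set (E n)) (hA : ∀ n i, MeasurableSet (A n i))
    {Ω : Type*} [MeasurableSpace Ω] {ρ : Measure Ω} {x : ι → Ω → ℝ} (hx0 : ∀ i ω, 0 ≤ x i ω)
    (hx : ∀ i, Integrable (x i) ρ)
    (hun : ∀ T : Finset ι, ∀ hT : T.Nonempty,
      Tendsto (fun n => a n * (μ n).real {y | ∃ i ∈ T, y ∈ A n i}) atTop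
        (𝓝 (∫ ω, T.sup' hT (fun i => x i ω) ∂ρ)))
    (T : Finset ι) (hT : T.Nonempty) :
    Tendsto (fun n => a n * (μ n).real {y | ∀ i ∈ T, y ∈ A n i}) atTop
        (𝓝 (∫ ω, T.inf' hT (fun i => x i ω) ∂ρ)) := by
  -- The detour through `NNReal` gives the maximum over the empty set the value `0`.
  let M : Finset ι → Ω → ℝ := fun B ω => ((B.sup fun i => (x i ω).toNNReal : NNReal) : ℝ)
  have M_empty : ∀ ω, M ∅ ω = 0 := fun ω => by simp [M]
  have M_insert : ∀ i B ω, M (insert i B) ω = max (x i ω) (M B ω) := fun i B ω => by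
    simp only [M, Finset.sup_insert, NNReal.coe_max, Real.coe_toNNReal _ (hx0 i ω)]
  have M_sup' : ∀ B : Finset ι, ∀ hB : B.Nonempty, ∀ ω,
      M B ω = B.sup' hB (fun i => x i ω) := by
    intro B hB ω
    induction hB using Finset.Nonempty.cons_induction with
    | singleton i => simp [M, hx0]
    | cons i B hi hB ih => rw [Finset.sup'_cons hB, Finset.cons_eq_insert, M_insert, ih]
  have M_int : ∀ B, Integrable (M B) ρ := by
    intro B
    induction B using Finset.induction_on with
    | empty => simp only [show M ∅ = 0 from funext M_empty]; exact integrable_zero _ _ _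
    | insert i B _ ih =>
      rw [show M (insert i B) = x i ⊔ M B from funext (M_insert i B)]
      exact (hx i).sup ih
  have inf_int : ∀ C : Finset ι, ∀ hC : C.Nonempty,
      Integrable (fun ω => C.inf' hC (fun i => x i ω)) ρ := by
    intro C hC
    induction hC using Finset.Nonempty.cons_induction with
    | singleton i => simpa using hx i
    | cons i B hi hB ih => simp only [Finset.inf'_cons hB]; exact (hx i).inf ih
  have un : ∀ B : Finset ι, Tendsto (fun n => a n * (μ n).real {y | ∃ i ∈ B, y ∈ A n i}) atTop
      (𝓝 (∫ ω, M B ω ∂ρ)) := by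
    intro B
    rcases B.eq_empty_or_nonempty with rfl | hB
    · simp [M_empty]
    · simp only [M_sup' B hB]
      exact hun B hB
  have meas_ex : ∀ n (B : Finset ι), MeasurableSet {y | ∃ i ∈ B, y ∈ A n i} := by
    intro n B
    have : {y | ∃ i ∈ B, y ∈ A n i} = ⋃ i ∈ B, A n i := by ext; simp
    rw [this]
    exact B.measurableSet_biUnion fun i _ => hA n i
  -- Inclusion-exclusion in a form that permits induction on `C`: forbidding the sets indexed by `B`
  -- corresponds to the positive part of `min_C - max_B`. The wanted limit is the case `B = ∅`.
  have key : ∀ C : Finset ι, ∀ hC : C.Nonempty, ∀ B : Finset ι,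
      Tendsto (fun n => a n * (μ n).real {y | (∀ i ∈ C, y ∈ A n i) ∧ ¬ ∃ i ∈ B, y ∈ A n i}) atTop
        (𝓝 (∫ ω, max (C.inf' hC (fun i => x i ω) - M B ω) 0 ∂ρ)) := by
    intro C hC
    induction hC using Finset.Nonempty.cons_induction with
    | singleton i =>
      intro B
      have h := (un (insert i B)).sub (un B)
      rw [← integral_sub (M_int _) (M_int _)] at h
      convert h using 2 with n
      · rw [← mul_sub, ← measureReal_sdiff _ (meas_ex n B)]
        · congr 2
          ext y
          simp only [Finset.mem_singleton, forall_eq, Finset.mem_insert, exists_eq_or_imp,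
            Set.mem_ofPred_eq, Set.mem_sdiff]
          by_cases hB : ∃ j ∈ B, y ∈ A n j <;> simp [hB]
        · rintro y ⟨j, hj, hy⟩
          exact ⟨j, Finset.mem_insert_of_mem hj, hy⟩
      · congr 1 with ω
        rw [M_insert, Finset.inf'_singleton, ← max_sub_sub_right, sub_self]
    | cons i C hi hC ih =>
      intro B
      have h := (ih B).sub (ih (insert i B))
      have hint : ∀ D, Integrable (fun ω => max (C.inf' hC (fun i => x i ω) - M D ω) 0) ρ :=
        fun D => ((inf_int C hC).sub (M_int D)).sup (integrable_zero _ _ _)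
      rw [← integral_sub (hint _) (hint _)] at h
      convert h using 2 with n
      · rw [← mul_sub, ← measureReal_sdiff]
        · congr 2
          ext y
          simp only [Finset.mem_cons, forall_eq_or_imp, Finset.mem_insert, exists_eq_or_imp,
            Set.mem_ofPred_eq, Set.mem_sdiff]
          by_cases hB : ∃ j ∈ B, y ∈ A n j <;> simp [hB]
          exact ⟨fun h => ⟨h.2, fun _ => h.1⟩, fun h => ⟨h.2 h.1, h.1⟩⟩
        · rintro y ⟨hy, hn⟩
          exact ⟨hy, fun ⟨j, hj, hyj⟩ => hn ⟨j, Finset.mem_insert_of_mem hj, hyj⟩⟩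
        · have : {y | (∀ j ∈ C, y ∈ A n j) ∧ ¬ ∃ j ∈ insert i B, y ∈ A n j}
              = (⋂ j ∈ C, A n j) \ {y | ∃ j ∈ insert i B, y ∈ A n j} := by ext; simp
          rw [this]
          exact (C.measurableSet_biInter fun j _ => hA n j).diff (meas_ex n _)
      -- The pointwise identity is `(c - m)⁺ - (c - max x m)⁺ = (min x c - m)⁺`.
      · congr 1 with ω
        rw [M_insert, Finset.inf'_cons hC]
        grind
  refine (key T hT ∅).congr' (.of_forall fun n => by simp) |>.trans_eq ?_
  congr 2 with ω
  rw [M_empty, sub_zero, max_eq_left]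
  exact Finset.le_inf' _ _ fun i _ => hx0 i ω

/-! ### Open and closed sets in `C(S, ℝ)` -/

section ContinuousFunctions

variable {S : Type*} [TopologicalSpace S] [CompactSpace S]

theorem isOpen_setOf_forall_lt_apply (f : C(S, ℝ)) : IsOpen {g : C(S, ℝ) | ∀ s, f s < g s} := by
  have h := (ContinuousMap.isOpen_setOfPred_mapsTo (X := S) (Y := ℝ) isCompact_univ
    (isOpen_Ioi (a := 0))).preimage (continuous_id.sub (continuous_const (y := f)))
  convert h using 1
  ext g
  simp [Set.MapsTo]

theorem isOpen_setOf_forall_apply_lt (f : C(S, ℝ)) : IsOpen {g : C(S, ℝ) | ∀ s, g s < f s} := by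
  have h := (ContinuousMap.isOpen_setOfPred_mapsTo (X := S) (Y := ℝ) isCompact_univ
    (isOpen_Iio (a := 0))).preimage (continuous_id.sub (continuous_const (y := f)))
  convert h using 1
  ext g
  simp [Set.MapsTo]

theorem isClosed_setOf_forall_apply_le {S : Type*} [TopologicalSpace S] (T : Set S) (f : S → ℝ) :
    IsClosed {g : C(S, ℝ) | ∀ s ∈ T, g s ≤ f s} := by
  simp only [Set.ofPred_forall]
  exact isClosed_biInter fun s _ => isClosed_le (continuous_eval_const s) continuous_const

theorem continuous_iInf_apply_mul [Nonempty S] (f : C(S, ℝ)) :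
    Continuous fun g : C(S, ℝ) => ⨅ s, f s * g s := by
  have h := isCompact_univ.continuous_sInf (K := (Set.univ : Set S))
    (f := fun (g : C(S, ℝ)) s => f s * g s) (by fun_prop)
  simpa [Set.image_univ, iInf] using h

end ContinuousFunctions

/-! ### Continuity and approximation of the dual `D`-norm function -/

section Generators

variable {S : Type*} [MetricSpace S] [CompactSpace S] [Nonempty S]
  [MeasurableSpace C(S, ℝ)] [BorelSpace C(S, ℝ)] {Ω : Type*} [MeasurableSpace Ω]
  {Z : Ω → C(S, ℝ)} {ρ : Measure Ω}

namespace IsDNormGenerator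

/-- A non-integrable function has integral `0` by convention, which contradicts mean one. -/
theorem integrable_eval (hZ : IsDNormGenerator Z ρ) (s : S) : Integrable (fun ω => Z ω s) ρ := by
  by_contra h
  exact zero_ne_one ((integral_undef h).symm.trans (hZ.mean s))

theorem bddBelow_abs_mul (hZ : IsDNormGenerator Z ρ) (f : S → ℝ) (ω : Ω) :
    BddBelow (Set.range fun s => |f s| * Z ω s) :=
  ⟨0, by rintro _ ⟨s, rfl⟩; exact mul_nonneg (abs_nonneg _) (hZ.nonneg ω s)⟩

theorem iInf_abs_mul_nonneg (hZ : IsDNormGenerator Z ρ) (f : S → ℝ) (ω : Ω) :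
    0 ≤ ⨅ s, |f s| * Z ω s :=
  le_ciInf fun s => mul_nonneg (abs_nonneg _) (hZ.nonneg ω s)

theorem integrable_iInf (hZ : IsDNormGenerator Z ρ) (f : C(S, ℝ)) :
    Integrable (fun ω => ⨅ s, |f s| * Z ω s) ρ := by
  let s : S := Classical.arbitrary S
  refine ((hZ.integrable_eval s).const_mul |f s|).mono' ?_ (.of_forall fun ω => ?_)
  · exact ((continuous_iInf_apply_mul |f|).measurable.comp_aemeasurable
      hZ.aemeasurable).aestronglyMeasurable
  · rw [Real.norm_of_nonneg (hZ.iInf_abs_mul_nonneg f ω)]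
    exact ciInf_le (hZ.bddBelow_abs_mul f ω) s

theorem dualDNorm_nonneg (hZ : IsDNormGenerator Z ρ) (f : S → ℝ) : 0 ≤ dualDNorm Z ρ f :=
  integral_nonneg fun ω => hZ.iInf_abs_mul_nonneg f ω

/-- The infimum is at most the value at `s`, and `Z_s` has mean one. This makes `|m s| - dualDNorm Z
ρ m` nonnegative, as the Fatou lemma requires. -/
theorem dualDNorm_le_abs (hZ : IsDNormGenerator Z ρ) (f : C(S, ℝ)) (s : S) :
    dualDNorm Z ρ f ≤ |f s| := by
  calc dualDNorm Z ρ f ≤ ∫ ω, |f s| * Z ω s ∂ρ :=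
        integral_mono (hZ.integrable_iInf f) ((hZ.integrable_eval s).const_mul _)
          fun ω => ciInf_le (hZ.bddBelow_abs_mul f ω) s
    _ = |f s| := by rw [integral_const_mul, hZ.mean, mul_one]

theorem bddAbove_range (z : C(S, ℝ)) : BddAbove (Set.range fun s => z s) :=
  (isCompact_range z.continuous).bddAbove

/-- Since `|f s| ≤ |g s| + ‖f - g‖` at each point, the dual function is Lipschitz with constant `E
(sup Z)`. -/
theorem dualDNorm_le_add (hZ : IsDNormGenerator Z ρ) (f g : C(S, ℝ)) :
    dualDNorm Z ρ f ≤ dualDNorm Z ρ g + ‖f - g‖ * ∫ ω, ⨆ s, Z ω s ∂ρ := by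
  rw [dualDNorm, dualDNorm, ← integral_const_mul,
    ← integral_add (hZ.integrable_iInf g) (hZ.integrable_sup.const_mul _)]
  refine integral_mono (hZ.integrable_iInf f)
    ((hZ.integrable_iInf g).add (hZ.integrable_sup.const_mul _)) fun ω => ?_
  simp only
  rw [← sub_le_iff_le_add]
  refine le_ciInf fun s => sub_le_iff_le_add.2 ?_
  refine (ciInf_le (hZ.bddBelow_abs_mul f ω) s).trans ?_
  have h1 : |f s| ≤ |g s| + ‖f - g‖ := by
    have := (f - g).norm_coe_le_norm s
    rw [ContinuousMap.sub_apply, Real.norm_eq_abs] at this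
    linarith [abs_sub_abs_le_abs_sub (f s) (g s)]
  have h2 : Z ω s ≤ ⨆ s, Z ω s := le_ciSup (bddAbove_range (Z ω)) s
  calc |f s| * Z ω s ≤ (|g s| + ‖f - g‖) * Z ω s :=
        mul_le_mul_of_nonneg_right h1 (hZ.nonneg ω s)
    _ = |g s| * Z ω s + ‖f - g‖ * Z ω s := by ring
    _ ≤ _ := by gcongr

theorem continuous_dualDNorm (hZ : IsDNormGenerator Z ρ) :
    Continuous fun f : C(S, ℝ) => dualDNorm Z ρ f := by
  refine (LipschitzWith.of_dist_le_mul (K := (∫ ω, ⨆ s, Z ω s ∂ρ).toNNReal)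
    fun f g => ?_).continuous
  have hpos : 0 ≤ ∫ ω, ⨆ s, Z ω s ∂ρ := integral_nonneg fun ω => Real.iSup_nonneg (hZ.nonneg ω)
  rw [Real.coe_toNNReal _ hpos, Real.dist_eq, dist_eq_norm, abs_sub_le_iff]
  have h1 := hZ.dualDNorm_le_add f g
  have h2 := hZ.dualDNorm_le_add g f
  rw [norm_sub_rev g f] at h2
  constructor <;> linarith

end IsDNormGenerator

/-- Finite `1 / (k + 1)`-nets of a compact space. -/
theorem exists_finset_nets (S : Type*) [MetricSpace S] [CompactSpace S] [Nonempty S] :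
    ∃ T : ℕ → Finset S, (∀ k, (T k).Nonempty) ∧
      ∀ k s, ∃ t ∈ T k, dist s t < 1 / ((k : ℝ) + 1) := by
  have h : ∀ k : ℕ, ∃ T : Finset S, ∀ s, ∃ t ∈ T, dist s t < 1 / ((k : ℝ) + 1) := fun k => by
    obtain ⟨t, -, hfin, ht⟩ := finite_cover_balls_of_compact (isCompact_univ (X := S))
      (e := 1 / ((k : ℝ) + 1)) (by positivity)
    refine ⟨hfin.toFinset, fun s => ?_⟩
    simpa using ht (Set.mem_univ s)
  choose T hT using h
  refine ⟨T, fun k => ?_, hT⟩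
  obtain ⟨t, ht, -⟩ := hT k (Classical.arbitrary S)
  exact ⟨t, ht⟩

/-- By compactness the minimum is attained, and net points approach the minimizer. -/
theorem tendsto_inf'_nets {T : ℕ → Finset S} (hT : ∀ k, (T k).Nonempty)
    (hnet : ∀ k s, ∃ t ∈ T k, dist s t < 1 / ((k : ℝ) + 1)) (x : C(S, ℝ)) :
    Tendsto (fun k => (T k).inf' (hT k) x) atTop (𝓝 (⨅ s, x s)) := by
  have hbdd : BddBelow (Set.range fun s => x s) := (isCompact_range x.continuous).bddBelow
  obtain ⟨s₀, -, hs₀⟩ := isCompact_univ.exists_isMinOn Set.univ_nonempty x.continuous.continuousOn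
  choose t ht hd using fun k => hnet k s₀
  have hlim : Tendsto t atTop (𝓝 s₀) := by
    refine tendsto_iff_dist_tendsto_zero.2 (squeeze_zero (fun _ => dist_nonneg) (fun k => ?_)
      tendsto_one_div_add_atTop_nhds_zero_nat)
    rw [dist_comm]
    exact (hd k).le
  have hinf : ⨅ s, x s = x s₀ :=
    le_antisymm (ciInf_le hbdd s₀) (le_ciInf fun s => hs₀ (Set.mem_univ s))
  refine tendsto_of_tendsto_of_tendsto_of_le_of_le tendsto_const_nhds
    (hinf ▸ (x.continuous.tendsto s₀).comp hlim) (fun k => ?_) fun k => ?_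
  · exact Finset.le_inf' _ _ fun s _ => ciInf_le hbdd s
  · exact Finset.inf'_le _ (ht k)

theorem IsDNormGenerator.tendsto_integral_inf'_nets (hZ : IsDNormGenerator Z ρ)
    {T : ℕ → Finset S} (hT : ∀ k, (T k).Nonempty)
    (hnet : ∀ k s, ∃ t ∈ T k, dist s t < 1 / ((k : ℝ) + 1)) (f : C(S, ℝ)) :
    Tendsto (fun k => ∫ ω, (T k).inf' (hT k) (fun t => |f t| * Z ω t) ∂ρ) atTop
      (𝓝 (dualDNorm Z ρ f)) := by
  refine tendsto_integral_of_dominated_convergence (fun ω => ‖f‖ * ⨆ s, Z ω s) (fun k => ?_)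
    (hZ.integrable_sup.const_mul _) (fun k => .of_forall fun ω => ?_) (.of_forall fun ω => ?_)
  · refine AEMeasurable.aestronglyMeasurable ?_
    have hc : Continuous fun z : C(S, ℝ) => (T k).inf' (hT k) (fun t => |f t| * z t) :=
      Continuous.finset_inf'_apply (hT k) fun t _ =>
        continuous_const.mul (continuous_eval_const t)
    exact hc.measurable.comp_aemeasurable hZ.aemeasurable
  · obtain ⟨t, ht⟩ := id (hT k)
    rw [Real.norm_of_nonneg (Finset.le_inf' _ _ fun t _ =>
      mul_nonneg (abs_nonneg _) (hZ.nonneg ω t))]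
    refine (Finset.inf'_le _ ht).trans ?_
    exact mul_le_mul (f.norm_coe_le_norm t) (le_ciSup (bddAbove_range (Z ω)) t)
      (hZ.nonneg ω t) (norm_nonneg _)
  · exact tendsto_inf'_nets hT hnet (|f| * Z ω)

end Generators

/-! ### The law of `η` -/

section StandardMaxStable

variable {S : Type*} [MetricSpace S] [CompactSpace S] [Nonempty S]
  [MeasurableSpace C(S, ℝ)] [BorelSpace C(S, ℝ)] {Ω Ω' : Type*} [MeasurableSpace Ω]
  [MeasurableSpace Ω'] {Z : Ω' → C(S, ℝ)} {ρ : Measure Ω'} {η : Ω → C(S, ℝ)} {Q : Measure Ω}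
  [IsProbabilityMeasure Q]

theorem mem_functionSpaceE_of_continuous (f : C(S, ℝ)) : (f : S → ℝ) ∈ functionSpaceE S := by
  refine ⟨⟨‖f‖, f.norm_coe_le_norm⟩, ?_⟩
  simp [f.continuous.continuousAt]

/-- Discontinuities can occur only on the finite set `T`. Such functions encode the
finite-dimensional distributions of `η`. -/
theorem mem_functionSpaceE_indicator (T : Finset S) (f : S → ℝ) :
    (T : Set S).indicator f ∈ functionSpaceE S := by
  refine ⟨⟨∑ t ∈ T, |f t|, fun s => ?_⟩, T.finite_toSet.subset fun s hs => ?_⟩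
  · by_cases h : s ∈ (T : Set S)
    · rw [Set.indicator_of_mem h]
      exact Finset.single_le_sum (f := fun t => |f t|) (fun t _ => abs_nonneg _) h
    · rw [Set.indicator_of_notMem h, abs_zero]
      exact Finset.sum_nonneg fun t _ => abs_nonneg _
  · by_contra h
    refine hs ?_
    have hev : (T : Set S).indicator f =ᶠ[𝓝 s] fun _ => 0 := by
      filter_upwards [T.finite_toSet.isClosed.isOpen_compl.mem_nhds h] with y hy
      exact Set.indicator_of_notMem hy f
    exact (continuousAt_congr hev).2 continuousAt_const

theorem iSup_abs_indicator_mul {T : Finset S} (hT : T.Nonempty) (f : S → ℝ) {z : S → ℝ}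
    (hz : ∀ s, 0 ≤ z s) :
    ⨆ s, |(T : Set S).indicator f s| * z s = T.sup' hT fun t => |f t| * z t := by
  have hle : ∀ s, |(T : Set S).indicator f s| * z s ≤ T.sup' hT fun t => |f t| * z t := by
    intro s
    by_cases h : s ∈ (T : Set S)
    · rw [Set.indicator_of_mem h]
      exact Finset.le_sup' (fun t => |f t| * z t) h
    · rw [Set.indicator_of_notMem h, abs_zero, zero_mul]
      obtain ⟨t, ht⟩ := id hT
      exact (mul_nonneg (abs_nonneg _) (hz t)).trans (Finset.le_sup' (fun t => |f t| * z t) ht)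
  refine le_antisymm (ciSup_le hle) (Finset.sup'_le _ _ fun t ht => ?_)
  refine le_trans (le_of_eq ?_) (le_ciSup ⟨_, by rintro _ ⟨s, rfl⟩; exact hle s⟩ t)
  rw [Set.indicator_of_mem (by exact_mod_cast ht)]

namespace GeneratesDNormOf

theorem ae_le_zero (hZ : GeneratesDNormOf Z ρ η Q) (hη : AEMeasurable η Q) :
    ∀ᵐ m ∂Q.map η, ∀ s, m s ≤ 0 := by
  have h := hZ.2 0 (mem_functionSpaceE_of_continuous (0 : C(S, ℝ))) (fun _ => le_rfl)
  have h0 : dNorm Z ρ 0 = 0 := by simp [dNorm]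
  rw [h0, neg_zero, Real.exp_zero] at h
  have hcl : MeasurableSet {m : C(S, ℝ) | ∀ s, m s ≤ 0} := by
    simpa using (isClosed_setOf_forall_apply_le Set.univ fun _ : S => (0 : ℝ)).measurableSet
  have hp := Measure.isProbabilityMeasure_map (μ := Q) hη
  rw [ae_iff_measure_eq hcl.nullMeasurableSet, measure_univ,
    Measure.map_apply_of_aemeasurable hη hcl]
  rw [Measure.real, ENNReal.toReal_eq_one_iff] at h
  exact h

/-- Off `T` the indicator is `0`, where the constraint holds almost surely because `η ≤ 0`. -/
theorem map_real_forall_mem_le (hZ : GeneratesDNormOf Z ρ η Q) (hη : AEMeasurable η Q)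
    {T : Finset S} (hT : T.Nonempty) {f : S → ℝ} (hf : ∀ s, f s ≤ 0) :
    (Q.map η).real {m | ∀ t ∈ T, m t ≤ f t}
      = Real.exp (-∫ ω, T.sup' hT (fun t => |f t| * Z ω t) ∂ρ) := by
  have h := hZ.2 _ (mem_functionSpaceE_indicator T f) fun s =>
    Set.indicator_nonpos (fun s _ => hf s) s
  simp only [dNorm, iSup_abs_indicator_mul hT f (hZ.1.nonneg _)] at h
  have hcl : IsClosed {m : C(S, ℝ) | ∀ t ∈ T, m t ≤ f t} :=
    isClosed_setOf_forall_apply_le (T : Set S) f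
  rw [← h, map_measureReal_apply_of_aemeasurable hη hcl.measurableSet]
  refine measureReal_congr ?_
  filter_upwards [ae_of_ae_map hη (hZ.ae_le_zero hη)] with ω hω
  refine propext ⟨fun hT s => ?_, fun hT t ht => ?_⟩
  · by_cases hs : s ∈ (T : Set S)
    · rw [Set.indicator_of_mem hs]
      exact hT s hs
    · rw [Set.indicator_of_notMem hs]
      exact hω s
  · have := hT t
    rwa [Set.indicator_of_mem (by exact_mod_cast ht)] at this

theorem map_real_forall_le (hZ : GeneratesDNormOf Z ρ η Q) (hη : AEMeasurable η Q)
    {f : C(S, ℝ)} (hf : ∀ s, f s ≤ 0) :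
    (Q.map η).real {m | ∀ s, m s ≤ f s} = Real.exp (-dNorm Z ρ f) := by
  rw [← hZ.2 f (mem_functionSpaceE_of_continuous f) hf, map_measureReal_apply_of_aemeasurable hη
    (by simpa using (isClosed_setOf_forall_apply_le (Set.univ : Set S) f).measurableSet)]
  rfl

theorem map_real_forall_lt_pos (hZ : GeneratesDNormOf Z ρ η Q) (hη : AEMeasurable η Q)
    {f : C(S, ℝ)} (hf : ∀ s, f s ≤ 0) : 0 < (Q.map η).real {m | ∀ s, m s < f s} := by
  have h := hZ.map_real_forall_le hη (f := f - 1) fun s => by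
    simp only [ContinuousMap.sub_apply, ContinuousMap.one_apply]; linarith [hf s]
  have hp := Measure.isProbabilityMeasure_map (μ := Q) hη
  refine (Real.exp_pos _).trans_le (h.symm.trans_le (measureReal_mono fun m hm s => ?_))
  have := hm s
  simp only [ContinuousMap.sub_apply, ContinuousMap.one_apply] at this
  linarith

/-- The probability of `η ≤ -1/(k+1)` is `exp (-E (sup Z) / (k+1))`, which tends to one. Strict
negativity is needed because the exceedance limits are proved only for `f < 0`. -/
theorem ae_lt_zero (hZ : GeneratesDNormOf Z ρ η Q) (hη : AEMeasurable η Q) :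
    ∀ᵐ m ∂Q.map η, ∀ s, m s < 0 := by
  have hp := Measure.isProbabilityMeasure_map (μ := Q) hη
  have hO := isOpen_setOf_forall_apply_lt (0 : C(S, ℝ))
  have hcl : MeasurableSet {m : C(S, ℝ) | ∀ s, m s < 0} := hO.measurableSet
  rw [ae_iff_measure_eq hcl.nullMeasurableSet, measure_univ]
  refine (ENNReal.toReal_eq_one_iff _).1 (le_antisymm measureReal_le_one ?_)
  have hlim : Tendsto (fun k : ℕ => Real.exp (-(1 / ((k : ℝ) + 1) * ∫ ω, ⨆ s, Z ω s ∂ρ))) atTop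
      (𝓝 1) := by
    have := (Real.continuous_exp.tendsto _).comp
      ((tendsto_one_div_add_atTop_nhds_zero_nat (𝕜 := ℝ)).mul_const (∫ ω, ⨆ s, Z ω s ∂ρ)).neg
    simpa [Function.comp_def] using this
  refine le_of_tendsto hlim (.of_forall fun k => ?_)
  have hk : (0 : ℝ) < 1 / ((k : ℝ) + 1) := by positivity
  have h := hZ.map_real_forall_le hη (f := ContinuousMap.const S (-(1 / ((k : ℝ) + 1))))
    fun s => by simpa using hk.le
  have hd : dNorm Z ρ (ContinuousMap.const S (-(1 / ((k : ℝ) + 1))))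
      = 1 / ((k : ℝ) + 1) * ∫ ω, ⨆ s, Z ω s ∂ρ := by
    simp only [dNorm, ContinuousMap.const_apply, abs_neg, abs_of_pos hk]
    rw [← integral_const_mul]
    congr 1 with ω
    exact (Real.mul_iSup_of_nonneg hk.le _).symm
  rw [← hd, ← h]
  refine measureReal_mono fun m hm s => ?_
  have := hm s
  simp only [ContinuousMap.const_apply] at this
  linarith

end GeneratesDNormOf

namespace IsStandardMaxStableProcess

theorem map_real_apply_le (hη : IsStandardMaxStableProcess η Q) (s : S) {x : ℝ} (hx : x ≤ 0) :
    (Q.map η).real {m | m s ≤ x} = Real.exp x := by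
  rw [← hη.margin s x hx, map_measureReal_apply_of_aemeasurable hη.aemeasurable
    (isClosed_le (continuous_eval_const s) continuous_const).measurableSet]
  rfl

theorem map_apply_eq_null (hη : IsStandardMaxStableProcess η Q) (s : S) {x : ℝ} (hx : x < 0) :
    (Q.map η) {m | m s = x} = 0 := by
  have hp := Measure.isProbabilityMeasure_map (μ := Q) hη.aemeasurable
  rw [← measureReal_eq_zero_iff]
  refine le_antisymm ?_ measureReal_nonneg
  have hlim : Tendsto (fun k : ℕ => Real.exp x - Real.exp (x - 1 / ((k : ℝ) + 1))) atTop
      (𝓝 0) := by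
    have := (tendsto_const_nhds (x := Real.exp x)).sub ((Real.continuous_exp.tendsto _).comp
      ((tendsto_const_nhds (x := x)).sub (tendsto_one_div_add_atTop_nhds_zero_nat (𝕜 := ℝ))))
    simpa using this
  refine ge_of_tendsto hlim (.of_forall fun k => ?_)
  have hk : (0 : ℝ) < 1 / ((k : ℝ) + 1) := by positivity
  rw [← hη.map_real_apply_le s hx.le, ← hη.map_real_apply_le s (x := x - 1 / ((k : ℝ) + 1))
    (by linarith), ← measureReal_sdiff]
  · refine measureReal_mono fun m hm => ⟨le_of_eq hm, fun h => ?_⟩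
    have h1 : m s = x := hm
    have h2 : m s ≤ x - 1 / ((k : ℝ) + 1) := h
    linarith
  · intro m hm
    have h2 : m s ≤ x - 1 / ((k : ℝ) + 1) := hm
    exact h2.trans (by linarith)
  · exact (isClosed_le (continuous_eval_const s) continuous_const).measurableSet

/-- Layer-cake formula for a standard exponential variable. -/
theorem lintegral_abs_apply (hη : IsStandardMaxStableProcess η Q) (s : S) :
    ∫⁻ m, ENNReal.ofReal |m s| ∂Q.map η = 1 := by
  have hp := Measure.isProbabilityMeasure_map (μ := Q) hη.aemeasurable
  have hneg : ∀ᵐ m ∂Q.map η, m s ≤ 0 := by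
    have h := hη.map_real_apply_le s le_rfl
    rw [Real.exp_zero, Measure.real, ENNReal.toReal_eq_one_iff] at h
    rw [ae_iff_measure_eq, measure_univ]
    · exact h
    · exact (isClosed_le (continuous_eval_const s) continuous_const).measurableSet.nullMeasurableSet
  rw [lintegral_eq_lintegral_meas_le _ (.of_forall fun m => abs_nonneg _)
    (continuous_eval_const s).abs.measurable.aemeasurable]
  have h1 : ∫⁻ t in Set.Ioi (0 : ℝ), (Q.map η) {m | t ≤ |m s|}
      = ∫⁻ t in Set.Ioi (0 : ℝ), ENNReal.ofReal (Real.exp (-t)) := by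
    refine setLIntegral_congr_fun measurableSet_Ioi fun t ht => ?_
    rw [← hη.map_real_apply_le s (neg_nonpos.2 (le_of_lt ht)), ofReal_measureReal]
    refine measure_congr ?_
    filter_upwards [hneg] with m hm
    refine propext ?_
    change t ≤ |m s| ↔ m s ≤ -t
    rw [abs_of_nonpos hm, le_neg]
  rw [h1, ← ofReal_integral_eq_lintegral_ofReal (integrableOn_exp_neg_Ioi 0)
    (.of_forall fun t => (Real.exp_pos _).le), integral_exp_neg_Ioi_zero, ENNReal.ofReal_one]

end IsStandardMaxStableProcess

end StandardMaxStable

/-! ### Exchangeability of independent copies -/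

section Exchangeable

variable {Ω E : Type*} [MeasurableSpace Ω] [MeasurableSpace E] {P : Measure Ω}
  [IsProbabilityMeasure P] {X : ℕ → Ω → E} {ν : Measure E}

theorem ProbabilityTheory.iIndepFun.map_comp_eq_pi (hX : iIndepFun X P)
    (hm : ∀ i, AEMeasurable (X i) P) (hν : ∀ i, P.map (X i) = ν) {n : ℕ} {σ : Fin n → ℕ}
    (hσ : σ.Injective) :
    P.map (fun ω i => X (σ i) ω) = Measure.pi fun _ => ν := by
  have h := (hX.precomp hσ).map_fun_eq_pi_map fun i => hm (σ i)
  simpa only [hν] using h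

variable {R : E → E → Prop}

theorem measurableSet_forall_rel_last (hR : MeasurableSet {p : E × E | R p.1 p.2}) (n : ℕ) :
    MeasurableSet {x : Fin (n + 1) → E | ∀ i, i ≠ Fin.last n → R (x i) (x (Fin.last n))} := by
  simp only [Set.ofPred_forall]
  refine MeasurableSet.iInter fun i => MeasurableSet.iInter fun _ => ?_
  exact hR.preimage ((measurable_pi_apply (X := fun _ : Fin (n + 1) => E) i).prodMk
    (measurable_pi_apply (Fin.last n)))

/-- Swapping `k` with `n` moves the distinguished index to the last place, so every champion event
has the same probability under the product law. -/
theorem rel_champion_eq_preimage {k n : ℕ} (hk : k ≤ n) :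
    {ω | ∀ j ≤ n, j ≠ k → R (X j ω) (X k ω)}
      = (fun ω (i : Fin (n + 1)) => X (Equiv.swap k n i) ω) ⁻¹'
        {x | ∀ i, i ≠ Fin.last n → R (x i) (x (Fin.last n))} := by
  ext ω
  simp only [Set.mem_ofPred_eq, Set.mem_preimage, Fin.val_last, Equiv.swap_apply_right]
  constructor
  · intro h i hi
    have hin : (i : ℕ) ≠ n := fun h => hi (Fin.ext h)
    refine h _ ?_ ?_
    · have := i.is_le
      rw [Equiv.swap_apply_def]
      split_ifs <;> omega
    · rw [Equiv.swap_apply_def]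
      split_ifs <;> omega
  · intro h j hj hjk
    have hle : Equiv.swap k n j ≤ n := by
      rw [Equiv.swap_apply_def]
      split_ifs <;> omega
    have := h ⟨Equiv.swap k n j, Nat.lt_succ_of_le hle⟩ fun he => by
      have he := congrArg Fin.val he
      simp only [Fin.val_last] at he
      rw [Equiv.swap_apply_def] at he
      split_ifs at he <;> omega
    simpa using this

theorem ProbabilityTheory.iIndepFun.nullMeasurableSet_champion
    (hm : ∀ i, AEMeasurable (X i) P)
    (hR : MeasurableSet {p : E × E | R p.1 p.2}) {k n : ℕ} (hk : k ≤ n) :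
    NullMeasurableSet {ω | ∀ j ≤ n, j ≠ k → R (X j ω) (X k ω)} P := by
  rw [rel_champion_eq_preimage hk]
  exact (aemeasurable_pi_lambda _ fun i => hm _).nullMeasurableSet_preimage
    (measurableSet_forall_rel_last hR n)

theorem ProbabilityTheory.iIndepFun.measureReal_champion (hX : iIndepFun X P)
    (hm : ∀ i, AEMeasurable (X i) P) (hν : ∀ i, P.map (X i) = ν)
    (hR : MeasurableSet {p : E × E | R p.1 p.2}) {k n : ℕ} (hk : k ≤ n) :
    P.real {ω | ∀ j ≤ n, j ≠ k → R (X j ω) (X k ω)} = P.real {ω | ∀ i < n, R (X i ω) (X n ω)} := by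
  have hlast : {ω | ∀ i < n, R (X i ω) (X n ω)} = {ω | ∀ j ≤ n, j ≠ n → R (X j ω) (X n ω)} := by
    ext ω
    exact forall_congr' fun i => by rw [lt_iff_le_and_ne, and_imp]
  have h : ∀ k ≤ n, P.real {ω | ∀ j ≤ n, j ≠ k → R (X j ω) (X k ω)}
      = (Measure.pi fun _ : Fin (n + 1) => ν).real
        {x | ∀ i, i ≠ Fin.last n → R (x i) (x (Fin.last n))} := fun k hk => by
    rw [rel_champion_eq_preimage hk, ← map_measureReal_apply_of_aemeasurable
      (aemeasurable_pi_lambda _ fun i => hm _) (measurableSet_forall_rel_last hR n),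
      hX.map_comp_eq_pi hm hν (σ := fun i : Fin (n + 1) => Equiv.swap k n i)
        ((Equiv.injective _).comp Fin.val_injective)]
  rw [hlast, h k hk, h n le_rfl]

theorem setOf_exists_champion_eq (n : ℕ) :
    {ω | ∃ k ≤ n, ∀ j ≤ n, j ≠ k → R (X j ω) (X k ω)}
      = ⋃ k ∈ Finset.range (n + 1), {ω | ∀ j ≤ n, j ≠ k → R (X j ω) (X k ω)} := by
  ext ω
  simp

theorem ProbabilityTheory.iIndepFun.measureReal_exists_champion_le (hX : iIndepFun X P)
    (hm : ∀ i, AEMeasurable (X i) P) (hν : ∀ i, P.map (X i) = ν)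
    (hR : MeasurableSet {p : E × E | R p.1 p.2}) (n : ℕ) :
    P.real {ω | ∃ k ≤ n, ∀ j ≤ n, j ≠ k → R (X j ω) (X k ω)}
      ≤ (n + 1 : ℝ) * P.real {ω | ∀ i < n, R (X i ω) (X n ω)} := by
  rw [setOf_exists_champion_eq]
  refine (measureReal_biUnion_finset_le _ _).trans (le_of_eq ?_)
  rw [Finset.sum_congr rfl fun k hk =>
    hX.measureReal_champion hm hν hR (Nat.lt_succ_iff.1 (Finset.mem_range.1 hk))]
  simp

/-- Asymmetry of `R` makes the champion events disjoint, so the union bound is an equality. -/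
theorem ProbabilityTheory.iIndepFun.measureReal_exists_champion (hX : iIndepFun X P)
    (hm : ∀ i, AEMeasurable (X i) P) (hν : ∀ i, P.map (X i) = ν)
    (hR : MeasurableSet {p : E × E | R p.1 p.2}) (hasymm : ∀ x y, R x y → ¬ R y x) (n : ℕ) :
    P.real {ω | ∃ k ≤ n, ∀ j ≤ n, j ≠ k → R (X j ω) (X k ω)}
      = (n + 1 : ℝ) * P.real {ω | ∀ i < n, R (X i ω) (X n ω)} := by
  rw [setOf_exists_champion_eq, measureReal_biUnion_finset₀]
  · rw [Finset.sum_congr rfl fun k hk =>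
      hX.measureReal_champion hm hν hR (Nat.lt_succ_iff.1 (Finset.mem_range.1 hk))]
    simp
  · intro k hk l hl hkl
    refine Disjoint.aedisjoint (Set.disjoint_left.2 fun ω h1 h2 => ?_)
    have hk' := Nat.lt_succ_iff.1 (Finset.mem_range.1 hk)
    have hl' := Nat.lt_succ_iff.1 (Finset.mem_range.1 hl)
    exact hasymm _ _ (h1 l hl' hkl.symm) (h2 k hk' hkl)
  · exact fun k hk => iIndepFun.nullMeasurableSet_champion hm hR
      (Nat.lt_succ_iff.1 (Finset.mem_range.1 hk))

end Exchangeable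

/-! ### Maxima of independent copies -/

section Maxima

variable {S : Type*} [MetricSpace S] [CompactSpace S]
  [MeasurableSpace C(S, ℝ)] [BorelSpace C(S, ℝ)] {Ω : Type*} [MeasurableSpace Ω] {P : Measure Ω}
  [IsProbabilityMeasure P] {X : ℕ → Ω → C(S, ℝ)} {ν : Measure C(S, ℝ)}

theorem maxFirst_apply_le_iff (x : ℕ → C(S, ℝ)) (n : ℕ) (s : S) (a : ℝ) :
    maxFirst x n s ≤ a ↔ ∀ i ≤ n, x i s ≤ a := by
  simp [maxFirst, ContinuousMap.sup'_apply]

theorem maxFirst_apply_lt_iff (x : ℕ → C(S, ℝ)) (n : ℕ) (s : S) (a : ℝ) :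
    maxFirst x n s < a ↔ ∀ i ≤ n, x i s < a := by
  simp [maxFirst, ContinuousMap.sup'_apply]

theorem le_maxFirst_apply (x : ℕ → C(S, ℝ)) {i n : ℕ} (hi : i ≤ n) (s : S) :
    x i s ≤ maxFirst x n s :=
  (maxFirst_apply_le_iff x n s _).1 le_rfl i hi

theorem ProbabilityTheory.iIndepFun.measureReal_maxFirst_le (hX : iIndepFun X P)
    (hm : ∀ i, AEMeasurable (X i) P) (hν : ∀ i, P.map (X i) = ν) (n : ℕ) (T : Set S) (f : S → ℝ) :
    P.real {ω | ∀ s ∈ T, maxFirst (fun i => X i ω) n s ≤ f s}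
      = ν.real {m | ∀ s ∈ T, m s ≤ f s} ^ (n + 1) := by
  have hcl := (isClosed_setOf_forall_apply_le T f).measurableSet
  have h := hX.measure_inter_preimage_eq_mul (Finset.range (n + 1))
    (sets := fun _ => {m | ∀ s ∈ T, m s ≤ f s}) fun _ _ => hcl
  have hset : {ω | ∀ s ∈ T, maxFirst (fun i => X i ω) n s ≤ f s}
      = ⋂ i ∈ Finset.range (n + 1), X i ⁻¹' {m | ∀ s ∈ T, m s ≤ f s} := by
    ext ω
    simp only [Set.mem_ofPred_eq, maxFirst_apply_le_iff, Set.mem_iInter, Finset.mem_range,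
      Nat.lt_succ_iff, Set.mem_preimage]
    exact ⟨fun h i hi s hs => h s hs i hi, fun h s hs i hi => h i hi s hs⟩
  rw [hset, Measure.real, h, Finset.prod_congr rfl fun i _ => by
    rw [← Measure.map_apply_of_aemeasurable (hm i) hcl, hν i]]
  simp [Measure.real]

/-- A bound for the probability that exactly one of the first `n + 1` members of an independent
sequence lies in `B` while all the others lie in `C`. -/
theorem ProbabilityTheory.iIndepFun.mul_measureReal_le_maxFirst (hX : iIndepFun X P)
    (hm : ∀ i, AEMeasurable (X i) P) (hν : ∀ i, P.map (X i) = ν) (n : ℕ)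
    {B C D : Set C(S, ℝ)} (hB : MeasurableSet B) (hC : MeasurableSet C) (hBC : Disjoint B C)
    (hD : ∀ x : ℕ → C(S, ℝ), ∀ k ≤ n, x k ∈ B → (∀ j ≤ n, j ≠ k → x j ∈ C) → maxFirst x n ∈ D) :
    (n + 1 : ℝ) * (ν.real B * ν.real C ^ n) ≤ P.real {ω | maxFirst (fun i => X i ω) n ∈ D} := by
  classical
  -- `A k` puts the `k`-th member in `B` and all others in `C`. For `k ≠ l` these events are
  -- disjoint because the `k`-th member cannot lie in both sets.
  let A : ℕ → Set Ω := fun k => ⋂ i ∈ Finset.range (n + 1), X i ⁻¹' (if i = k then B else C)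
  have hmeas : ∀ i k : ℕ, MeasurableSet (if i = k then B else C) := fun i k => by
    split_ifs <;> assumption
  have hA : ∀ k ∈ Finset.range (n + 1), P.real (A k) = ν.real B * ν.real C ^ n := by
    intro k hk
    rw [Measure.real, hX.measure_inter_preimage_eq_mul (Finset.range (n + 1))
      (sets := fun i => if i = k then B else C) fun i _ => hmeas i k,
      Finset.prod_congr rfl fun i _ => by
        rw [← Measure.map_apply_of_aemeasurable (hm i) (hmeas i k), hν i],
      ← Finset.mul_prod_erase _ _ hk, if_pos rfl, ENNReal.toReal_mul,
      Finset.prod_congr rfl fun i hi => by rw [if_neg (Finset.ne_of_mem_erase hi)]]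
    simp [Measure.real, Finset.card_erase_of_mem hk]
  have hnull : ∀ k ∈ Finset.range (n + 1), NullMeasurableSet (A k) P := fun k _ =>
    Finset.nullMeasurableSet_biInter _ fun i _ => (hm i).nullMeasurableSet_preimage (hmeas i k)
  have hdisj : Set.Pairwise (↑(Finset.range (n + 1))) (Function.onFun (AEDisjoint P) A) := by
    intro k hk l hl hkl
    refine Disjoint.aedisjoint (Set.disjoint_left.2 fun ω h1 h2 => ?_)
    have h1 := Set.mem_iInter₂.1 h1 k hk
    have h2 := Set.mem_iInter₂.1 h2 k hk
    rw [if_pos rfl] at h1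
    rw [if_neg hkl] at h2
    exact Set.disjoint_left.1 hBC h1 h2
  calc (n + 1 : ℝ) * (ν.real B * ν.real C ^ n) = P.real (⋃ k ∈ Finset.range (n + 1), A k) := by
        rw [measureReal_biUnion_finset₀ hdisj hnull, Finset.sum_congr rfl hA]
        simp
    _ ≤ _ := by
        refine measureReal_mono fun ω hω => ?_
        obtain ⟨k, hk, hω⟩ := Set.mem_iUnion₂.1 hω
        refine hD _ k (Nat.lt_succ_iff.1 (Finset.mem_range.1 hk)) ?_ fun j hj hjk => ?_
        · simpa using Set.mem_iInter₂.1 hω k hk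
        · simpa [hjk] using Set.mem_iInter₂.1 hω j (Finset.mem_range.2 (Nat.lt_succ_of_le hj))

theorem continuous_finset_sup'_continuousMap {ι : Type*} {I : Finset ι} (hI : I.Nonempty) :
    Continuous fun x : ι → C(S, ℝ) => I.sup' hI x := by
  refine ContinuousMap.continuous_of_continuous_uncurry _ ?_
  simp only [Function.uncurry_def, ContinuousMap.sup'_apply]
  exact Continuous.finset_sup'_apply hI fun i _ =>
    ((continuous_apply i).comp continuous_fst).eval continuous_snd

theorem univ_range_succ_nonempty (n : ℕ) :
    (Finset.univ : Finset (Finset.range (n + 1))).Nonempty :=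
  ⟨⟨0, by simp⟩, Finset.mem_univ _⟩

theorem maxFirst_eq_univ_sup' (x : ℕ → C(S, ℝ)) (n : ℕ) :
    maxFirst x n = Finset.univ.sup' (univ_range_succ_nonempty n)
      fun i : Finset.range (n + 1) => x i := by
  refine eq_of_forall_ge_iff fun c => ?_
  simp [maxFirst]

theorem ProbabilityTheory.iIndepFun.indepFun_maxFirst (hX : iIndepFun X P)
    (hm : ∀ i, AEMeasurable (X i) P) (n : ℕ) :
    IndepFun (fun ω => maxFirst (fun i => X i ω) n) (X (n + 1)) P := by
  have h := hX.indepFun_finset₀ (Finset.range (n + 1)) {n + 1} (by simp) hm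
  have h' := h.comp (continuous_finset_sup'_continuousMap
      (univ_range_succ_nonempty n)).measurable
    (measurable_pi_apply (⟨n + 1, Finset.mem_singleton_self _⟩ : ({n + 1} : Finset ℕ)))
  simp only [maxFirst_eq_univ_sup']
  exact h'

theorem aemeasurable_maxFirst (hm : ∀ i, AEMeasurable (X i) P) (n : ℕ) :
    AEMeasurable (fun ω => maxFirst (fun i => X i ω) n) P := by
  simp only [maxFirst_eq_univ_sup']
  exact (continuous_finset_sup'_continuousMap (univ_range_succ_nonempty n)).measurable
    |>.comp_aemeasurable (aemeasurable_pi_lambda _ fun i => hm i)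

/-- Fubini: the next observation is independent of the maximum, so one may condition on the latter.
-/
theorem ProbabilityTheory.iIndepFun.lintegral_measureReal_rel_maxFirst (hX : iIndepFun X P)
    (hm : ∀ i, AEMeasurable (X i) P) (hν : ∀ i, P.map (X i) = ν) (n : ℕ)
    {R : C(S, ℝ) → C(S, ℝ) → Prop} (hR : MeasurableSet {p : C(S, ℝ) × C(S, ℝ) | R p.1 p.2}) :
    ∫⁻ m, ENNReal.ofReal (ν.real {y | R m y}) ∂P.map (fun ω => maxFirst (fun i => X i ω) n)
      = ENNReal.ofReal (P.real {ω | R (maxFirst (fun i => X i ω) n) (X (n + 1) ω)}) := by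
  have : IsProbabilityMeasure ν := hν 0 ▸ Measure.isProbabilityMeasure_map (hm 0)
  have hM := aemeasurable_maxFirst hm n
  have h := (indepFun_iff_map_prod_eq_prod_map_map hM (hm (n + 1))).1 (hX.indepFun_maxFirst hm n)
  have h1 : P {ω | R (maxFirst (fun i => X i ω) n) (X (n + 1) ω)}
      = P.map (fun ω => (maxFirst (fun i => X i ω) n, X (n + 1) ω))
        {p : C(S, ℝ) × C(S, ℝ) | R p.1 p.2} := by
    rw [Measure.map_apply_of_aemeasurable (hM.prodMk (hm _)) hR]
    rfl
  rw [ofReal_measureReal, lintegral_congr fun m => ofReal_measureReal]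
  rw [h1, h, Measure.prod_apply hR, hν]
  rfl

end Maxima

/-! ### Portmanteau inequalities -/

section WeakConvergence

variable {E Ω Ω' : Type*} [TopologicalSpace E] [MeasurableSpace E] [OpensMeasurableSpace E]
  [HasOuterApproxClosed E]
  [MeasurableSpace Ω] [MeasurableSpace Ω'] {P : Measure Ω} [IsProbabilityMeasure P]
  {Q : Measure Ω'} [IsProbabilityMeasure Q] {M : ℕ → Ω → E} {η : Ω' → E}

theorem MeasureTheory.TendstoInDistribution.le_liminf_map_of_isOpen
    (h : TendstoInDistribution M atTop η (fun _ => P) Q) {G : Set E} (hG : IsOpen G) :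
    Q.map η G ≤ liminf (fun n => P.map (M n) G) atTop :=
  ProbabilityMeasure.le_liminf_measure_open_of_tendsto h.tendsto hG

theorem MeasureTheory.TendstoInDistribution.eventually_lt_map_real_of_isOpen
    (h : TendstoInDistribution M atTop η (fun _ => P) Q) {G : Set E} (hG : IsOpen G) {a : ℝ}
    (ha : a < (Q.map η).real G) : ∀ᶠ n in atTop, a < (P.map (M n)).real G := by
  rcases lt_or_ge a 0 with h0 | h0
  · exact .of_forall fun n => h0.trans_le measureReal_nonneg
  have hlt : ENNReal.ofReal a < liminf (fun n => P.map (M n) G) atTop :=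
    ((ENNReal.ofReal_lt_iff_lt_toReal h0 (measure_ne_top _ _)).2 ha).trans_le
      (h.le_liminf_map_of_isOpen hG)
  filter_upwards [eventually_lt_of_lt_liminf hlt] with n hn
  exact (ENNReal.ofReal_lt_iff_lt_toReal h0 (measure_ne_top _ _)).1 hn

theorem MeasureTheory.TendstoInDistribution.eventually_map_real_lt_of_isClosed
    (h : TendstoInDistribution M atTop η (fun _ => P) Q) {F : Set E} (hF : IsClosed F) {a : ℝ}
    (ha : (Q.map η).real F < a) : ∀ᶠ n in atTop, (P.map (M n)).real F < a := by
  have hlt : limsup (fun n => P.map (M n) F) atTop < ENNReal.ofReal a :=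
    lt_of_le_of_lt (b := Q.map η F)
      (ProbabilityMeasure.limsup_measure_closed_le_of_tendsto h.tendsto hF)
      ((ENNReal.lt_ofReal_iff_toReal_lt (measure_ne_top _ _)).2 ha)
  filter_upwards [eventually_lt_of_limsup_lt hlt] with n hn
  exact (ENNReal.lt_ofReal_iff_toReal_lt (measure_ne_top _ _)).1 hn

end WeakConvergence

/-! ### Upcrossings over short distances -/

section Oscillation

variable {S : Type*} [MetricSpace S] [CompactSpace S]

/-- Functions that rise from below `f` to above `f + ε` within distance `1 / (k + 1)`. -/
def upcrossingSet (f : C(S, ℝ)) (ε : ℝ) (k : ℕ) : Set C(S, ℝ) :=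
  {m | ∃ s t, dist s t ≤ 1 / ((k : ℝ) + 1) ∧ m s ≤ f s ∧ f t + ε ≤ m t}

/-- It is the projection of a closed set along the compact factor `S × S`. Closedness gives the
portmanteau upper bound. -/
theorem isClosed_upcrossingSet (f : C(S, ℝ)) (ε : ℝ) (k : ℕ) :
    IsClosed (upcrossingSet f ε k) := by
  have hcl : IsClosed {p : (S × S) × C(S, ℝ) | dist p.1.1 p.1.2 ≤ 1 / ((k : ℝ) + 1) ∧
      p.2 p.1.1 ≤ f p.1.1 ∧ f p.1.2 + ε ≤ p.2 p.1.2} := by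
    have h1 : Continuous fun p : (S × S) × C(S, ℝ) => p.2 p.1.1 := by fun_prop
    have h2 : Continuous fun p : (S × S) × C(S, ℝ) => p.2 p.1.2 := by fun_prop
    have h3 : Continuous fun p : (S × S) × C(S, ℝ) => f p.1.1 := by fun_prop
    have h4 : Continuous fun p : (S × S) × C(S, ℝ) => f p.1.2 + ε := by fun_prop
    have h5 : Continuous fun p : (S × S) × C(S, ℝ) => dist p.1.1 p.1.2 := by fun_prop
    exact (isClosed_le h5 continuous_const).inter ((isClosed_le h1 h3).inter (isClosed_le h4 h2))
  convert isClosedMap_snd_of_compactSpace _ hcl using 1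
  ext m
  simp [upcrossingSet]

theorem antitone_upcrossingSet (f : C(S, ℝ)) (ε : ℝ) : Antitone (upcrossingSet f ε) := by
  rintro k l hkl m ⟨s, t, hst, h⟩
  exact ⟨s, t, hst.trans (one_div_le_one_div_of_le (by positivity) (by gcongr)), h⟩

/-- An upcrossing raises `m - f` by at least `ε`, which uniform continuity excludes at short
distances. -/
theorem iInter_upcrossingSet (f : C(S, ℝ)) {ε : ℝ} (hε : 0 < ε) :
    ⋂ k, upcrossingSet f ε k = ∅ := by
  refine Set.eq_empty_iff_forall_notMem.2 fun m hm => ?_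
  have hu := CompactSpace.uniformContinuous_of_continuous (m - f).continuous
  obtain ⟨δ, hδ, h⟩ := Metric.uniformContinuous_iff.1 hu ε hε
  obtain ⟨k, hk⟩ := exists_nat_one_div_lt hδ
  obtain ⟨s, t, hst, h1, h2⟩ := Set.mem_iInter.1 hm k
  have := h (hst.trans_lt hk)
  rw [Real.dist_eq, ContinuousMap.sub_apply, ContinuousMap.sub_apply, abs_lt] at this
  linarith

end Oscillation

/-! ### Exceedances of a fixed function by one entry -/

section TriangularArray

variable {S : Type*} [MetricSpace S] [CompactSpace S] [Nonempty S]
  [MeasurableSpace C(S, ℝ)] [BorelSpace C(S, ℝ)] {Ω Ω₁ Ω₂ : Type*} [MeasurableSpace Ω]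
  [MeasurableSpace Ω₁] [MeasurableSpace Ω₂]
  {P : Measure Ω} [IsProbabilityMeasure P] {Q : Measure Ω₁} [IsProbabilityMeasure Q]
  {ρ : Measure Ω₂} {Z : Ω₂ → C(S, ℝ)} {η : Ω₁ → C(S, ℝ)}

/-- A triangular array with independent and identically distributed rows, whose row maxima
converge in distribution to `η`. -/
structure IsMaxConvergentArray (Y : ℕ → ℕ → Ω → C(S, ℝ)) (P : Measure Ω) [IsProbabilityMeasure P]
    (ν : ℕ → Measure C(S, ℝ)) (η : Ω₁ → C(S, ℝ)) (Q : Measure Ω₁) [IsProbabilityMeasure Q] :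
    Prop where
  indep : ∀ n, iIndepFun (Y n) P
  aemeasurable : ∀ n i, AEMeasurable (Y n i) P
  map_eq : ∀ n i, P.map (Y n i) = ν n
  tendsto : TendstoInDistribution (fun n ω => maxFirst (fun i => Y n i ω) n) atTop η
    (fun _ => P) Q

namespace IsMaxConvergentArray

variable {Y : ℕ → ℕ → Ω → C(S, ℝ)} {ν : ℕ → Measure C(S, ℝ)}

theorem isProbabilityMeasure (hY : IsMaxConvergentArray Y P ν η Q) (n : ℕ) :
    IsProbabilityMeasure (ν n) :=
  hY.map_eq n 0 ▸ Measure.isProbabilityMeasure_map (hY.aemeasurable n 0)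

theorem map_real_le (hY : IsMaxConvergentArray Y P ν η Q) (n : ℕ) (T : Set S) (f : S → ℝ) :
    (P.map fun ω => maxFirst (fun i => Y n i ω) n).real {m | ∀ s ∈ T, m s ≤ f s}
      = (ν n).real {m | ∀ s ∈ T, m s ≤ f s} ^ (n + 1) := by
  rw [map_measureReal_apply_of_aemeasurable (aemeasurable_maxFirst (hY.aemeasurable n) n)
    (isClosed_setOf_forall_apply_le T f).measurableSet]
  exact (hY.indep n).measureReal_maxFirst_le (hY.aemeasurable n) (hY.map_eq n) n T f

theorem tendsto_exists_lt (hY : IsMaxConvergentArray Y P ν η Q)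
    (hη : IsStandardMaxStableProcess η Q) (hZ : GeneratesDNormOf Z ρ η Q) {f : S → ℝ}
    (hf : ∀ s, f s < 0) (T : Finset S) (hT : T.Nonempty) :
    Tendsto (fun n : ℕ => (n + 1 : ℝ) * (ν n).real {y | ∃ t ∈ T, y ∈ {y : C(S, ℝ) | f t < y t}})
      atTop (𝓝 (∫ ω, T.sup' hT (fun t => |f t| * Z ω t) ∂ρ)) := by
  have hcl := isClosed_setOf_forall_apply_le (T : Set S) f
  -- A boundary point equals `f` at some `t ∈ T`, and the margins of `η` have no atoms below `0`.
  have hfr : Q.map η (frontier {m | ∀ s ∈ (T : Set S), m s ≤ f s}) = 0 := by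
    refine measure_mono_null (t := ⋃ t ∈ T, {m : C(S, ℝ) | m t = f t}) (fun m hm => ?_)
      ((measure_biUnion_null_iff T.countable_toSet).2 fun t _ => hη.map_apply_eq_null t (hf t))
    have hmem := hcl.frontier_subset hm
    by_contra hne
    simp only [Set.mem_iUnion, not_exists] at hne
    refine hm.2 (mem_interior.2 ⟨⋂ t ∈ T, {m : C(S, ℝ) | m t < f t}, fun g hg t ht => ?_, ?_, ?_⟩)
    · exact le_of_lt (Set.mem_iInter₂.1 hg t ht)
    · exact T.finite_toSet.isOpen_biInter fun t _ =>
        isOpen_lt (continuous_eval_const t) continuous_const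
    · exact Set.mem_iInter₂.2 fun t ht => lt_of_le_of_ne (hmem t ht) (hne t ht)
  have h1 : Tendsto (fun n => (P.map fun ω => maxFirst (fun i => Y n i ω) n)
      {m | ∀ s ∈ (T : Set S), m s ≤ f s}) atTop
      (𝓝 (Q.map η {m | ∀ s ∈ (T : Set S), m s ≤ f s})) :=
    ProbabilityMeasure.tendsto_measure_of_null_frontier_of_tendsto' hY.tendsto.tendsto hfr
  have h2 := (ENNReal.tendsto_toReal (measure_ne_top _ _)).comp h1
  have h3 : Tendsto (fun n => (ν n).real {m | ∀ s ∈ (T : Set S), m s ≤ f s} ^ (n + 1)) atTop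
      (𝓝 (Real.exp (-∫ ω, T.sup' hT (fun t => |f t| * Z ω t) ∂ρ))) := by
    rw [← hZ.map_real_forall_mem_le hη.aemeasurable hT fun s => (hf s).le]
    refine h2.congr fun n => ?_
    rw [← hY.map_real_le n]
    rfl
  refine (tendsto_mul_one_sub_of_tendsto_pow (fun n => measureReal_nonneg) h3).congr fun n => ?_
  have := hY.isProbabilityMeasure n
  rw [← probReal_compl_eq_one_sub hcl.measurableSet]
  congr 2
  ext y
  simp

theorem tendsto_forall_lt (hY : IsMaxConvergentArray Y P ν η Q)
    (hη : IsStandardMaxStableProcess η Q) (hZ : GeneratesDNormOf Z ρ η Q) {f : S → ℝ}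
    (hf : ∀ s, f s < 0) (T : Finset S) (hT : T.Nonempty) :
    Tendsto (fun n : ℕ => (n + 1 : ℝ) * (ν n).real {y | ∀ t ∈ T, f t < y t})
      atTop (𝓝 (∫ ω, T.inf' hT (fun t => |f t| * Z ω t) ∂ρ)) := by
  classical
  have := hY.isProbabilityMeasure
  exact tendsto_measureReal_iInter_of_iUnion ν (fun n => (n + 1 : ℝ))
    (fun _ t => {y : C(S, ℝ) | f t < y t}) (x := fun t ω => |f t| * Z ω t)
    (hA := fun _ t => (isOpen_lt continuous_const (continuous_eval_const t)).measurableSet)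
    (hx0 := fun t ω => mul_nonneg (abs_nonneg _) (hZ.1.nonneg ω t))
    (hx := fun t => (hZ.1.integrable_eval t).const_mul _)
    (hun := fun T hT => hY.tendsto_exists_lt hη hZ hf T hT) T hT

theorem tendsto_apply_lt (hY : IsMaxConvergentArray Y P ν η Q)
    (hη : IsStandardMaxStableProcess η Q) (hZ : GeneratesDNormOf Z ρ η Q) (s : S) {x : ℝ}
    (hx : x < 0) :
    Tendsto (fun n : ℕ => (n + 1 : ℝ) * (ν n).real {y | x < y s}) atTop (𝓝 |x|) := by
  have h := hY.tendsto_forall_lt hη hZ (f := fun _ => x) (fun _ => hx) {s}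
    (Finset.singleton_nonempty s)
  simpa [integral_const_mul, hZ.1.mean s] using h

/-- If one entry upcrosses while the others stay below `f`, the maximum upcrosses as well. Hence the
scaled upcrossing probability of one entry, times a factor bounded below by `P (M n < f)`, is at
most the upcrossing probability of `M n`, which is small for large `k` and then large `n`. -/
theorem eventually_upcrossing_le (hY : IsMaxConvergentArray Y P ν η Q)
    (hη : IsStandardMaxStableProcess η Q) (hZ : GeneratesDNormOf Z ρ η Q) {f : C(S, ℝ)}
    (hf : ∀ s, f s < 0) {ε κ : ℝ} (hε : 0 < ε) (hκ : 0 < κ) :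
    ∃ K, ∀ k ≥ K, ∀ᶠ n : ℕ in atTop, (n + 1 : ℝ) * (ν n).real (upcrossingSet f ε k) ≤ κ := by
  have hQ := Measure.isProbabilityMeasure_map (μ := Q) hη.aemeasurable
  set p := (Q.map η).real {m | ∀ s, m s < f s} with hp_def
  have hp : 0 < p := hZ.map_real_forall_lt_pos hη.aemeasurable fun s => (hf s).le
  have hlim : Tendsto (fun k => (Q.map η).real (upcrossingSet f ε k)) atTop (𝓝 0) := by
    have h := tendsto_measure_iInter_atTop (μ := Q.map η)
      (fun k => (isClosed_upcrossingSet f ε k).measurableSet.nullMeasurableSet)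
      (antitone_upcrossingSet f ε) ⟨0, measure_ne_top _ _⟩
    rw [iInter_upcrossingSet f hε, measure_empty] at h
    exact (ENNReal.tendsto_toReal ENNReal.zero_ne_top).comp h
  obtain ⟨K, hK⟩ := eventually_atTop.1
    -- The factor `p / 2` is what remains of `p` for large `n`; it cancels at the end.
    (hlim.eventually (gt_mem_nhds (show 0 < κ * (p / 2) by positivity)))
  refine ⟨K, fun k hk => ?_⟩
  filter_upwards [hY.tendsto.eventually_map_real_lt_of_isClosed (isClosed_upcrossingSet f ε k)
    (hK k hk), hY.tendsto.eventually_lt_map_real_of_isOpen (isOpen_setOf_forall_apply_lt f)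
    (half_lt_self hp)] with n h1 h2
  have := hY.isProbabilityMeasure n
  have hcl := isClosed_setOf_forall_apply_le (Set.univ : Set S) f
  have hM := aemeasurable_maxFirst (hY.aemeasurable n) n
  have hMP := Measure.isProbabilityMeasure_map (μ := P) hM
  have h3 : p / 2 ≤ (ν n).real {m | ∀ s ∈ Set.univ, m s ≤ f s} ^ n := by
    calc p / 2 ≤ _ := h2.le
      _ ≤ (P.map fun ω => maxFirst (fun i => Y n i ω) n).real {m | ∀ s ∈ Set.univ, m s ≤ f s} :=
          measureReal_mono fun m hm s _ => (hm s).le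
      _ = (ν n).real {m | ∀ s ∈ Set.univ, m s ≤ f s} ^ (n + 1) := hY.map_real_le n _ _
      _ ≤ _ := pow_le_pow_of_le_one measureReal_nonneg measureReal_le_one n.le_succ
  have h4 := (hY.indep n).mul_measureReal_le_maxFirst (hY.aemeasurable n) (hY.map_eq n) n
    (isClosed_upcrossingSet f ε k).measurableSet hcl.measurableSet (D := upcrossingSet f ε k)
    (Set.disjoint_left.2 fun m ⟨s, t, _, _, ht⟩ hle => by
      have := hle t trivial
      linarith)
    (fun x i hi ⟨s, t, hst, hs, ht⟩ hj => by
      refine ⟨s, t, hst, (maxFirst_apply_le_iff _ _ _ _).2 fun j hjn => ?_,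
        ht.trans (le_maxFirst_apply x hi t)⟩
      rcases eq_or_ne j i with rfl | hne
      · exact hs
      · exact hj j hjn hne s trivial)
  rw [map_measureReal_apply_of_aemeasurable hM (isClosed_upcrossingSet f ε k).measurableSet] at h1
  have h5 : (n + 1 : ℝ) * (ν n).real (upcrossingSet f ε k) * (p / 2) ≤ κ * (p / 2) := by
    calc _ ≤ (n + 1 : ℝ) * (ν n).real (upcrossingSet f ε k)
          * (ν n).real {m | ∀ s ∈ Set.univ, m s ≤ f s} ^ n := by gcongr
      _ ≤ _ := by rw [mul_assoc]; exact h4.trans h1.le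
  exact le_of_mul_le_mul_right h5 (by positivity)

end IsMaxConvergentArray

theorem IsDNormGenerator.eventually_dualDNorm_add_const (hZ : IsDNormGenerator Z ρ) {f : C(S, ℝ)}
    (hf : ∀ s, f s < 0) {U : Set ℝ} (hU : U ∈ 𝓝 (dualDNorm Z ρ f)) :
    ∀ᶠ ε in 𝓝 (0 : ℝ), (∀ s, (f + ContinuousMap.const S ε) s < 0) ∧
      dualDNorm Z ρ (f + ContinuousMap.const S ε : C(S, ℝ)) ∈ U := by
  have hc : Continuous fun ε : ℝ => f + ContinuousMap.const S ε :=
    continuous_const.add ContinuousMap.continuous_const'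
  have h0 : f + ContinuousMap.const S 0 = f := by ext; simp
  have h1 : ∀ᶠ g in 𝓝 (f + ContinuousMap.const S 0), ∀ s, g s < 0 := by
    rw [h0]
    exact (isOpen_setOf_forall_apply_lt (0 : C(S, ℝ))).mem_nhds hf
  have h2 : ∀ᶠ g : C(S, ℝ) in 𝓝 (f + ContinuousMap.const S 0), dualDNorm Z ρ g ∈ U := by
    rw [h0]
    exact hZ.continuous_dualDNorm.continuousAt hU
  exact hc.continuousAt.eventually (h1.and h2)

namespace IsMaxConvergentArray

variable {Y : ℕ → ℕ → Ω → C(S, ℝ)} {ν : ℕ → Measure C(S, ℝ)}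

/-- An entry above `f + ε` on a fine net either exceeds `f` everywhere or upcrosses from `f` to `f +
ε` near a net point; the second case is negligible. -/
theorem eventually_lt_forall_lt (hY : IsMaxConvergentArray Y P ν η Q)
    (hη : IsStandardMaxStableProcess η Q) (hZ : GeneratesDNormOf Z ρ η Q) {f : C(S, ℝ)}
    (hf : ∀ s, f s < 0) {a : ℝ} (ha : a < dualDNorm Z ρ f) :
    ∀ᶠ n : ℕ in atTop, a < (n + 1 : ℝ) * (ν n).real {y | ∀ s, f s < y s} := by
  obtain ⟨ε, ⟨hneg, hε'⟩, hε⟩ :=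
    (((hZ.1.eventually_dualDNorm_add_const hf (lt_mem_nhds ha)).filter_mono
      nhdsWithin_le_nhds).and (self_mem_nhdsWithin (s := Set.Ioi (0 : ℝ)))).exists
  set g : C(S, ℝ) := f + ContinuousMap.const S ε with hg
  have hlt : a < dualDNorm Z ρ g := hε'
  obtain ⟨T, hT, hnet⟩ := exists_finset_nets S
  obtain ⟨b, hab, hb⟩ := exists_between hlt
  obtain ⟨K, hK⟩ := hY.eventually_upcrossing_le hη hZ hf hε (sub_pos.2 hab)
  obtain ⟨k, hkK, hk⟩ := ((eventually_ge_atTop K).and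
    ((hZ.1.tendsto_integral_inf'_nets hT hnet g).eventually (lt_mem_nhds hb))).exists
  filter_upwards [hK k hkK, (hY.tendsto_forall_lt hη hZ hneg (T k) (hT k)).eventually
    (lt_mem_nhds hk)] with n h1 h2
  have := hY.isProbabilityMeasure n
  have h3 : (ν n).real {y | ∀ t ∈ T k, g t < y t}
      ≤ (ν n).real {y | ∀ s, f s < y s} + (ν n).real (upcrossingSet f ε k) := by
    refine (measureReal_mono fun y hy => ?_).trans (measureReal_union_le _ _)
    by_cases h : ∀ s, f s < y s
    · exact Or.inl h
    · push Not at h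
      obtain ⟨s, hs⟩ := h
      obtain ⟨t, ht, hd⟩ := hnet k s
      exact Or.inr ⟨s, t, hd.le, hs, (hy t ht).le⟩
  have h4 := mul_le_mul_of_nonneg_left h3 (show (0 : ℝ) ≤ n + 1 by positivity)
  rw [mul_add] at h4
  linarith

/-- Restricting the constraint to a finite net only enlarges the event. -/
theorem eventually_forall_lt_lt (hY : IsMaxConvergentArray Y P ν η Q)
    (hη : IsStandardMaxStableProcess η Q) (hZ : GeneratesDNormOf Z ρ η Q) {f : C(S, ℝ)}
    (hf : ∀ s, f s < 0) {a : ℝ} (ha : dualDNorm Z ρ f < a) :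
    ∀ᶠ n : ℕ in atTop, (n + 1 : ℝ) * (ν n).real {y | ∀ s, f s < y s} < a := by
  obtain ⟨T, hT, hnet⟩ := exists_finset_nets S
  obtain ⟨k, hk⟩ :=
    ((hZ.1.tendsto_integral_inf'_nets hT hnet f).eventually (gt_mem_nhds ha)).exists
  filter_upwards [(hY.tendsto_forall_lt hη hZ hf (T k) (hT k)).eventually (gt_mem_nhds hk)]
    with n hn
  have := hY.isProbabilityMeasure n
  refine lt_of_le_of_lt ?_ hn
  exact mul_le_mul_of_nonneg_left (measureReal_mono fun y hy t _ => hy t) (by positivity)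

end IsMaxConvergentArray

end TriangularArray

/-- The array compares observation `n + 1` with `n + 1` predecessors but scales by `n + 1` instead
of `n + 2`; the ratio tends to one. -/
theorem tendsto_add_one_mul_of_tendsto_succ {x : ℕ → ℝ} {a : ℝ}
    (h : Tendsto (fun n : ℕ => (n + 1 : ℝ) * x (n + 1)) atTop (𝓝 a)) :
    Tendsto (fun n : ℕ => (n + 1 : ℝ) * x n) atTop (𝓝 a) := by
  refine (tendsto_add_atTop_iff_nat 1).1 ?_
  have h1 : Tendsto (fun n : ℕ => 1 + 1 / ((n : ℝ) + 1)) atTop (𝓝 1) := by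
    simpa using (tendsto_one_div_add_atTop_nhds_zero_nat (𝕜 := ℝ)).const_add 1
  have h2 := h1.mul h
  rw [one_mul] at h2
  refine h2.congr fun n => ?_
  have : (n : ℝ) + 1 ≠ 0 := by positivity
  push_cast
  field_simp

/-! ### Measurability of the order relations -/

section Relations

variable {S : Type*} [MetricSpace S] [CompactSpace S] [MeasurableSpace C(S, ℝ)]
  [BorelSpace C(S, ℝ)]

theorem measurableSet_apply_lt_apply (s : S) :
    MeasurableSet {p : C(S, ℝ) × C(S, ℝ) | p.1 s < p.2 s} :=
  (isOpen_lt ((continuous_eval_const s).comp continuous_fst)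
    ((continuous_eval_const s).comp continuous_snd)).measurableSet

theorem measurableSet_apply_eq_apply (s : S) :
    MeasurableSet {p : C(S, ℝ) × C(S, ℝ) | p.2 s = p.1 s} :=
  (isClosed_eq ((continuous_eval_const s).comp continuous_snd)
    ((continuous_eval_const s).comp continuous_fst)).measurableSet

theorem measurableSet_forall_le :
    MeasurableSet {p : C(S, ℝ) × C(S, ℝ) | ∀ s, p.1 s ≤ p.2 s} := by
  simp only [Set.ofPred_forall]
  exact (isClosed_iInter fun s => isClosed_le ((continuous_eval_const s).comp continuous_fst)
    ((continuous_eval_const s).comp continuous_snd)).measurableSet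

theorem measurableSet_forall_lt :
    MeasurableSet {p : C(S, ℝ) × C(S, ℝ) | ∀ s, p.1 s < p.2 s} := by
  have h := (isOpen_setOf_forall_lt_apply (0 : C(S, ℝ))).preimage
    (continuous_snd.sub (continuous_fst (X := C(S, ℝ)) (Y := C(S, ℝ))))
  convert h.measurableSet using 1
  ext p
  simp

theorem measurable_measureReal_rel {ν : Measure C(S, ℝ)} [IsFiniteMeasure ν]
    {R : C(S, ℝ) → C(S, ℝ) → Prop} (hR : MeasurableSet {p : C(S, ℝ) × C(S, ℝ) | R p.1 p.2}) :
    Measurable fun m => ν.real {y | R m y} :=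
  (measurable_measure_prodMk_left hR).ennreal_toReal

end Relations

/-! ### Record probabilities in the array -/

section TriangularArray

variable {S : Type*} [MetricSpace S] [CompactSpace S] [Nonempty S]
  [MeasurableSpace C(S, ℝ)] [BorelSpace C(S, ℝ)] {Ω Ω₁ Ω₂ : Type*} [MeasurableSpace Ω]
  [MeasurableSpace Ω₁] [MeasurableSpace Ω₂]
  {P : Measure Ω} [IsProbabilityMeasure P] {Q : Measure Ω₁} [IsProbabilityMeasure Q]
  {ρ : Measure Ω₂} {Z : Ω₂ → C(S, ℝ)} {η : Ω₁ → C(S, ℝ)}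
  {Y : ℕ → ℕ → Ω → C(S, ℝ)} {ν : ℕ → Measure C(S, ℝ)}

namespace IsMaxConvergentArray

theorem lintegral_rel (hY : IsMaxConvergentArray Y P ν η Q) (n : ℕ)
    {R : C(S, ℝ) → C(S, ℝ) → Prop} (hR : MeasurableSet {p : C(S, ℝ) × C(S, ℝ) | R p.1 p.2}) :
    ∫⁻ m, ENNReal.ofReal ((n + 1 : ℝ) * (ν n).real {y | R m y})
        ∂P.map (fun ω => maxFirst (fun i => Y n i ω) n)
      = ENNReal.ofReal
        ((n + 1 : ℝ) * P.real {ω | R (maxFirst (fun i => Y n i ω) n) (Y n (n + 1) ω)}) := by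
  have := hY.isProbabilityMeasure n
  have hn : (0 : ℝ) ≤ n + 1 := by positivity
  simp only [ENNReal.ofReal_mul hn]
  rw [lintegral_const_mul _ (measurable_measureReal_rel hR).ennreal_ofReal,
    (hY.indep n).lintegral_measureReal_rel_maxFirst (hY.aemeasurable n) (hY.map_eq n) n hR]

theorem eventually_lt_mul_measureReal_rel (hY : IsMaxConvergentArray Y P ν η Q)
    {R : C(S, ℝ) → C(S, ℝ) → Prop} (hR : MeasurableSet {p : C(S, ℝ) × C(S, ℝ) | R p.1 p.2})
    {φ : C(S, ℝ) → ℝ} (hφ : Measurable φ) (hφ0 : ∀ m, 0 ≤ φ m)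
    (hconv : ∀ᵐ m ∂Q.map η, ∀ t < φ m, ∀ᶠ p : ℕ × C(S, ℝ) in atTop ×ˢ 𝓝 m,
      t < (p.1 + 1 : ℝ) * (ν p.1).real {y | R p.2 y})
    {a : ℝ} (ha0 : 0 ≤ a) (ha : ENNReal.ofReal a < ∫⁻ m, ENNReal.ofReal (φ m) ∂Q.map η) :
    ∀ᶠ n : ℕ in atTop,
      a < (n + 1 : ℝ) * P.real {ω | R (maxFirst (fun i => Y n i ω) n) (Y n (n + 1) ω)} := by
  have hprob := hY.isProbabilityMeasure
  have h := lintegral_le_liminf_lintegral_of_continuous_convergence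
    (fun G hG => hY.tendsto.le_liminf_map_of_isOpen hG) hφ
    (φs := fun n m => (n + 1 : ℝ) * (ν n).real {y | R m y})
    (fun n => (measurable_measureReal_rel hR).const_mul _) hφ0
    (fun n m => by positivity) hconv
  simp only [hY.lintegral_rel _ hR] at h
  filter_upwards [eventually_lt_of_lt_liminf (ha.trans_le h)] with n hn
  exact ((ENNReal.ofReal_lt_ofReal_iff_of_nonneg ha0).1 hn)

/-- Functions near `m` lie below `m + ε`, so exceeding `m + ε` suffices to exceed all of them. This
gives the local uniformity demanded by the Fatou lemma. -/
theorem eventually_lt_record (hY : IsMaxConvergentArray Y P ν η Q)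
    (hη : IsStandardMaxStableProcess η Q) (hZ : GeneratesDNormOf Z ρ η Q) {a : ℝ} (ha0 : 0 ≤ a)
    (ha : ENNReal.ofReal a < ∫⁻ m, ENNReal.ofReal (dualDNorm Z ρ m) ∂Q.map η) :
    ∀ᶠ n : ℕ in atTop,
      a < (n + 1 : ℝ) * P.real {ω | ∀ s, maxFirst (fun i => Y n i ω) n s < Y n (n + 1) ω s} := by
  refine hY.eventually_lt_mul_measureReal_rel (R := fun f g => ∀ s, f s < g s)
    measurableSet_forall_lt hZ.1.continuous_dualDNorm.measurable
    (fun m => hZ.1.dualDNorm_nonneg m) ?_ ha0 ha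
  filter_upwards [hZ.ae_lt_zero hη.aemeasurable] with m hm t ht
  obtain ⟨ε, ⟨hneg, hε'⟩, hε⟩ :=
    (((hZ.1.eventually_dualDNorm_add_const hm (lt_mem_nhds ht)).filter_mono
      nhdsWithin_le_nhds).and (self_mem_nhdsWithin (s := Set.Ioi (0 : ℝ)))).exists
  have hnhds : ∀ᶠ f in 𝓝 m, ∀ s, f s < (m + ContinuousMap.const S ε) s :=
    (isOpen_setOf_forall_apply_lt _).mem_nhds fun s => by
      have : (0 : ℝ) < ε := hε
      simpa using this
  filter_upwards [(hY.eventually_lt_forall_lt hη hZ hneg hε').prod_mk hnhds] with p hp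
  have := hY.isProbabilityMeasure p.1
  refine hp.1.trans_le ?_
  exact mul_le_mul_of_nonneg_left
    (measureReal_mono fun y hy s => (hp.2 s).trans (hy s)) (by positivity)

theorem eventually_lt_exceed_not_record (hY : IsMaxConvergentArray Y P ν η Q)
    (hη : IsStandardMaxStableProcess η Q) (hZ : GeneratesDNormOf Z ρ η Q) (s₀ : S) {a : ℝ}
    (ha0 : 0 ≤ a)
    (ha : ENNReal.ofReal a < ∫⁻ m, ENNReal.ofReal (|m s₀| - dualDNorm Z ρ m) ∂Q.map η) :
    ∀ᶠ n : ℕ in atTop,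
      a < (n + 1 : ℝ) * P.real {ω | maxFirst (fun i => Y n i ω) n s₀ < Y n (n + 1) ω s₀ ∧
        ¬ ∀ s, maxFirst (fun i => Y n i ω) n s ≤ Y n (n + 1) ω s} := by
  refine hY.eventually_lt_mul_measureReal_rel (R := fun f g => f s₀ < g s₀ ∧ ¬ ∀ s, f s ≤ g s)
    ((measurableSet_apply_lt_apply s₀).inter measurableSet_forall_le.compl)
    (φ := fun m => |m s₀| - dualDNorm Z ρ m)
    ((continuous_eval_const s₀).abs.sub hZ.1.continuous_dualDNorm).measurable
    (fun m => sub_nonneg.2 (hZ.1.dualDNorm_le_abs m s₀)) ?_ ha0 ha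
  filter_upwards [hZ.ae_lt_zero hη.aemeasurable] with m hm t ht
  -- Half the slack is spent on replacing `m s₀` by `m s₀ + ε`, half on replacing `m` by `m - ε`.
  set gap := (|m s₀| - dualDNorm Z ρ m - t) / 2 with hgap
  have hgap0 : 0 < gap := by rw [hgap]; linarith
  have hh := hZ.1.eventually_dualDNorm_add_const hm
    (gt_mem_nhds (show dualDNorm Z ρ m < dualDNorm Z ρ m + gap by linarith))
  have hhneg := (show Tendsto (fun ε : ℝ => -ε) (𝓝 0) (𝓝 0) by
    simpa using (continuous_neg (G := ℝ)).tendsto 0).eventually hh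
  obtain ⟨ε, ⟨⟨⟨hneg', -⟩, hneg, hε'⟩, hεgap⟩, hε⟩ :=
    ((((hh.and hhneg).and (gt_mem_nhds hgap0)).filter_mono
      nhdsWithin_le_nhds).and (self_mem_nhdsWithin (s := Set.Ioi (0 : ℝ)))).exists
  have hε0 : (0 : ℝ) < ε := hε
  have hlt : dualDNorm Z ρ (m + ContinuousMap.const S (-ε) : C(S, ℝ)) < dualDNorm Z ρ m + gap := hε'
  have hup : |m s₀| - gap < |m s₀ + ε| := by
    have h1 := hneg' s₀
    simp only [ContinuousMap.add_apply, ContinuousMap.const_apply] at h1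
    rw [abs_of_neg h1, abs_of_neg (hm s₀)]
    linarith
  have hnhds : ∀ᶠ f in 𝓝 m, (∀ s, (m + ContinuousMap.const S (-ε)) s < f s) ∧
      f s₀ < m s₀ + ε := by
    have h1 : ∀ᶠ f in 𝓝 m, ∀ s, (m + ContinuousMap.const S (-ε)) s < f s :=
      (isOpen_setOf_forall_lt_apply _).mem_nhds fun s => by simpa using hε0
    have h2 : ∀ᶠ f : C(S, ℝ) in 𝓝 m, f s₀ < m s₀ + ε :=
      (isOpen_lt (continuous_eval_const s₀) continuous_const).mem_nhds
        (show m s₀ < m s₀ + ε by linarith)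
    exact h1.and h2
  filter_upwards [((hY.eventually_forall_lt_lt hη hZ hneg hlt).and
    ((hY.tendsto_apply_lt hη hZ s₀ (hneg' s₀)).eventually (lt_mem_nhds hup))).prod_mk hnhds]
    with p ⟨⟨h1, h2⟩, h3, h4⟩
  have := hY.isProbabilityMeasure p.1
  -- For `f` near `m`, an entry above `m + ε` at `s₀` exceeds `f` there; if moreover it is at least
  -- `f` everywhere, then it exceeds `m - ε` everywhere.
  have h5 : (ν p.1).real {y | (m + ContinuousMap.const S ε) s₀ < y s₀}
      ≤ (ν p.1).real {y | p.2 s₀ < y s₀ ∧ ¬ ∀ s, p.2 s ≤ y s}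
        + (ν p.1).real {y | ∀ s, (m + ContinuousMap.const S (-ε)) s < y s} := by
    refine (measureReal_mono fun y hy => ?_).trans (measureReal_union_le _ _)
    by_cases h : ∀ s, p.2 s ≤ y s
    · exact Or.inr fun s => (h3 s).trans_le (h s)
    · exact Or.inl ⟨h4.trans hy, h⟩
  have h6 := mul_le_mul_of_nonneg_left h5 (show (0 : ℝ) ≤ p.1 + 1 by positivity)
  rw [mul_add] at h6
  have h7 : gap + gap = |m s₀| - dualDNorm Z ρ m - t := by rw [hgap]; ring
  linarith

theorem measureReal_tie_eq_zero (hY : IsMaxConvergentArray Y P ν η Q) (n : ℕ) (s : S)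
    (hna : ∀ x, ν n {y | y s = x} = 0) :
    P.real {ω | Y n (n + 1) ω s = maxFirst (fun i => Y n i ω) n s} = 0 := by
  have h := (hY.indep n).lintegral_measureReal_rel_maxFirst (hY.aemeasurable n) (hY.map_eq n) n
    (R := fun f g => g s = f s) (measurableSet_apply_eq_apply s)
  simp only [Measure.real, hna, ENNReal.toReal_zero, ENNReal.ofReal_zero, lintegral_zero] at h
  exact le_antisymm (ENNReal.ofReal_eq_zero.1 h.symm) measureReal_nonneg

/-- At a fixed point at most one of `n + 2` observations is a strict maximum, so even the factor `n
+ 2` would be allowed. -/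
theorem exceed_le_one (hY : IsMaxConvergentArray Y P ν η Q) (n : ℕ) (s : S) :
    (n + 1 : ℝ) * P.real {ω | maxFirst (fun i => Y n i ω) n s < Y n (n + 1) ω s} ≤ 1 := by
  have h := (hY.indep n).measureReal_exists_champion (hY.aemeasurable n) (hY.map_eq n)
    (R := fun f g => f s < g s) (measurableSet_apply_lt_apply s) (fun f g h => h.not_gt) (n + 1)
  have hset : {ω | maxFirst (fun i => Y n i ω) n s < Y n (n + 1) ω s}
      = {ω | ∀ i < n + 1, Y n i ω s < Y n (n + 1) ω s} := by
    ext ω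
    simp [maxFirst_apply_lt_iff]
  rw [hset]
  refine le_trans ?_ (h.symm.trans_le measureReal_le_one)
  gcongr
  linarith

/-- The two events are disjoint and, up to a tie at `s₀`, both force an exceedance at `s₀`; ties are
null because the margin has no atoms. -/
theorem weak_record_add_le_one (hY : IsMaxConvergentArray Y P ν η Q) (n : ℕ) (s₀ : S)
    (hna : ∀ x, ν n {y | y s₀ = x} = 0) :
    (n + 1 : ℝ) * P.real {ω | ∀ s, maxFirst (fun i => Y n i ω) n s ≤ Y n (n + 1) ω s}
      + (n + 1 : ℝ) * P.real {ω | maxFirst (fun i => Y n i ω) n s₀ < Y n (n + 1) ω s₀ ∧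
        ¬ ∀ s, maxFirst (fun i => Y n i ω) n s ≤ Y n (n + 1) ω s} ≤ 1 := by
  refine le_trans ?_ (hY.exceed_le_one n s₀)
  rw [← mul_add]
  refine mul_le_mul_of_nonneg_left ?_ (by positivity)
  have hM := aemeasurable_maxFirst (hY.aemeasurable n) n
  have hpair := hM.prodMk (hY.aemeasurable n (n + 1))
  have hnull : NullMeasurableSet {ω | maxFirst (fun i => Y n i ω) n s₀ < Y n (n + 1) ω s₀ ∧
      ¬ ∀ s, maxFirst (fun i => Y n i ω) n s ≤ Y n (n + 1) ω s} P :=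
    hpair.nullMeasurableSet_preimage
      ((measurableSet_apply_lt_apply s₀).inter measurableSet_forall_le.compl)
  have hdisj : Disjoint {ω | ∀ s, maxFirst (fun i => Y n i ω) n s ≤ Y n (n + 1) ω s}
      {ω | maxFirst (fun i => Y n i ω) n s₀ < Y n (n + 1) ω s₀ ∧
        ¬ ∀ s, maxFirst (fun i => Y n i ω) n s ≤ Y n (n + 1) ω s} :=
    Set.disjoint_left.2 fun ω h1 h2 => h2.2 h1
  rw [← measureReal_union₀ hnull hdisj.aedisjoint]
  refine (measureReal_mono (s₂ := {ω | maxFirst (fun i => Y n i ω) n s₀ < Y n (n + 1) ω s₀} ∪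
    {ω | Y n (n + 1) ω s₀ = maxFirst (fun i => Y n i ω) n s₀}) ?_).trans
    ((measureReal_union_le _ _).trans_eq ?_)
  · rintro ω (h | h)
    · rcases (h s₀).lt_or_eq with h | h
      · exact Or.inl h
      · exact Or.inr h.symm
    · exact Or.inl h.1
  · rw [hY.measureReal_tie_eq_zero n s₀ hna, add_zero]

theorem lintegral_dualDNorm_add (hη : IsStandardMaxStableProcess η Q)
    (hZ : GeneratesDNormOf Z ρ η Q) (s₀ : S) :
    ∫⁻ m, ENNReal.ofReal (dualDNorm Z ρ m) ∂Q.map η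
      + ∫⁻ m, ENNReal.ofReal (|m s₀| - dualDNorm Z ρ m) ∂Q.map η = 1 := by
  rw [← hη.lintegral_abs_apply s₀, ← lintegral_add_left
    hZ.1.continuous_dualDNorm.measurable.ennreal_ofReal]
  refine lintegral_congr fun m => ?_
  rw [← ENNReal.ofReal_add (hZ.1.dualDNorm_nonneg m)
    (sub_nonneg.2 (hZ.1.dualDNorm_le_abs m s₀))]
  ring_nf

/-- The scaled probabilities of strict and of weak records converge to the mean of the dual
`D`-norm function. -/
theorem tendsto_record (hY : IsMaxConvergentArray Y P ν η Q)
    (hη : IsStandardMaxStableProcess η Q) (hZ : GeneratesDNormOf Z ρ η Q) (s₀ : S)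
    (hna : ∀ n x, ν n {y | y s₀ = x} = 0) :
    Tendsto (fun n : ℕ => (n + 1 : ℝ) *
        P.real {ω | ∀ s, maxFirst (fun i => Y n i ω) n s < Y n (n + 1) ω s}) atTop
      (𝓝 (∫⁻ m, ENNReal.ofReal (dualDNorm Z ρ m) ∂Q.map η).toReal) ∧
    Tendsto (fun n : ℕ => (n + 1 : ℝ) *
        P.real {ω | ∀ s, maxFirst (fun i => Y n i ω) n s ≤ Y n (n + 1) ω s}) atTop
      (𝓝 (∫⁻ m, ENNReal.ofReal (dualDNorm Z ρ m) ∂Q.map η).toReal) := by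
  have hadd := lintegral_dualDNorm_add hη hZ s₀
  have hlow := fun a h0 => hY.eventually_lt_record hη hZ (a := a) h0
  have hhigh := fun a h0 => hY.eventually_lt_exceed_not_record hη hZ s₀ (a := a) h0
  set A := ∫⁻ m, ENNReal.ofReal (dualDNorm Z ρ m) ∂Q.map η
  set B := ∫⁻ m, ENNReal.ofReal (|m s₀| - dualDNorm Z ρ m) ∂Q.map η
  have hA : A ≠ ⊤ := fun h => by simp [h] at hadd
  have hB : B ≠ ⊤ := fun h => by simp [h] at hadd
  have hreal : A.toReal + B.toReal = 1 := by
    rw [← ENNReal.toReal_add hA hB, hadd, ENNReal.toReal_one]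
  have hle : ∀ n : ℕ,
      (n + 1 : ℝ) * P.real {ω | ∀ s, maxFirst (fun i => Y n i ω) n s < Y n (n + 1) ω s}
        ≤ (n + 1 : ℝ) * P.real {ω | ∀ s, maxFirst (fun i => Y n i ω) n s ≤ Y n (n + 1) ω s} :=
    fun n => mul_le_mul_of_nonneg_left (measureReal_mono fun ω h s => (h s).le) (by positivity)
  have h1 : ∀ a < A.toReal, ∀ᶠ n : ℕ in atTop, a < (n + 1 : ℝ) *
      P.real {ω | ∀ s, maxFirst (fun i => Y n i ω) n s < Y n (n + 1) ω s} := by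
    intro a ha
    rcases lt_or_ge a 0 with h0 | h0
    · exact .of_forall fun n => h0.trans_le (by positivity)
    · exact hlow a h0 ((ENNReal.ofReal_lt_iff_lt_toReal h0 hA).2 ha)
  -- The upper bound comes from the lower bound `1 - A` for the complementary event.
  have h2 : ∀ a > A.toReal, ∀ᶠ n : ℕ in atTop, (n + 1 : ℝ) *
      P.real {ω | ∀ s, maxFirst (fun i => Y n i ω) n s ≤ Y n (n + 1) ω s} < a := by
    intro a ha
    have h3 : ∀ᶠ n : ℕ in atTop, 1 - a < (n + 1 : ℝ) *
        P.real {ω | maxFirst (fun i => Y n i ω) n s₀ < Y n (n + 1) ω s₀ ∧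
          ¬ ∀ s, maxFirst (fun i => Y n i ω) n s ≤ Y n (n + 1) ω s} := by
      rcases lt_or_ge (1 - a) 0 with h0 | h0
      · exact .of_forall fun n => h0.trans_le (by positivity)
      · exact hhigh _ h0 ((ENNReal.ofReal_lt_iff_lt_toReal h0 hB).2 (by linarith))
    filter_upwards [h3] with n hn
    have := hY.weak_record_add_le_one n s₀ (hna n)
    linarith
  refine ⟨tendsto_order.2 ⟨h1, fun a ha => ?_⟩, tendsto_order.2 ⟨fun a ha => ?_, h2⟩⟩
  · filter_upwards [h2 a ha] with n hn using (hle n).trans_lt hn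
  · filter_upwards [h1 a ha] with n hn using hn.trans_le (hle n)

end IsMaxConvergentArray

theorem integrable_dualDNorm_comp (hη : IsStandardMaxStableProcess η Q)
    (hZ : GeneratesDNormOf Z ρ η Q) : Integrable (fun ω => dualDNorm Z ρ (η ω)) Q := by
  have hc := hZ.1.continuous_dualDNorm
  let s₀ : S := Classical.arbitrary S
  refine (integrable_map_measure hc.measurable.aestronglyMeasurable hη.aemeasurable).1
    ⟨hc.measurable.aestronglyMeasurable, ?_⟩
  rw [hasFiniteIntegral_iff_ofReal (.of_forall fun m : C(S, ℝ) => hZ.1.dualDNorm_nonneg m)]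
  refine lt_of_le_of_lt ?_ ENNReal.one_lt_top
  rw [← IsMaxConvergentArray.lintegral_dualDNorm_add hη hZ s₀]
  exact le_self_add

theorem integral_dualDNorm_comp (hη : IsStandardMaxStableProcess η Q)
    (hZ : GeneratesDNormOf Z ρ η Q) :
    ∫ ω, dualDNorm Z ρ (η ω) ∂Q
      = (∫⁻ m, ENNReal.ofReal (dualDNorm Z ρ m) ∂Q.map η).toReal := by
  have hc := hZ.1.continuous_dualDNorm
  rw [← integral_map (φ := η) (f := fun m : C(S, ℝ) => dualDNorm Z ρ m) hη.aemeasurable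
    hc.measurable.aestronglyMeasurable,
    integral_eq_lintegral_of_nonneg_ae (.of_forall fun m : C(S, ℝ) => hZ.1.dualDNorm_nonneg m)
      hc.measurable.aestronglyMeasurable]

end TriangularArray

/-! ### Standardization -/

section Standardize

variable {S : Type*} [MetricSpace S] [CompactSpace S]

theorem continuous_standardize (c d : C(S, ℝ)) (hc : ∀ s, 0 < c s) :
    Continuous (standardize c d hc) := by
  refine ContinuousMap.continuous_of_continuous_uncurry _ ?_
  have h1 : Continuous fun p : C(S, ℝ) × S => p.1 p.2 := by fun_prop
  have h2 : Continuous fun p : C(S, ℝ) × S => d p.2 := by fun_prop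
  have h3 : Continuous fun p : C(S, ℝ) × S => c p.2 := by fun_prop
  exact (h1.sub h2).div h3 fun p => (hc p.2).ne'

theorem standardize_lt_standardize_iff (c d : C(S, ℝ)) (hc : ∀ s, 0 < c s) (f g : C(S, ℝ))
    (s : S) : standardize c d hc f s < standardize c d hc g s ↔ f s < g s := by
  change (f s - d s) / c s < (g s - d s) / c s ↔ _
  rw [div_lt_div_iff_of_pos_right (hc s), sub_lt_sub_iff_right]

theorem standardize_le_standardize_iff (c d : C(S, ℝ)) (hc : ∀ s, 0 < c s) (f g : C(S, ℝ))
    (s : S) : standardize c d hc f s ≤ standardize c d hc g s ↔ f s ≤ g s := by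
  change (f s - d s) / c s ≤ (g s - d s) / c s ↔ _
  rw [div_le_div_iff_of_pos_right (hc s), sub_le_sub_iff_right]

variable [MeasurableSpace C(S, ℝ)] [BorelSpace C(S, ℝ)] {Ω₀ : Type*} [MeasurableSpace Ω₀]
  {P₀ : Measure Ω₀} {U₀ : Ω₀ → C(S, ℝ)}

theorem IsCopulaProcess.map_standardize_apply_eq (hU₀ : IsCopulaProcess U₀ P₀) (c d : C(S, ℝ))
    (hc : ∀ s, 0 < c s) (s : S) (x : ℝ) :
    (P₀.map U₀).map (standardize c d hc) {y | y s = x} = 0 := by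
  have hcont := continuous_standardize c d hc
  have hcl : MeasurableSet {y : C(S, ℝ) | y s = x} :=
    (isClosed_eq (continuous_eval_const s) continuous_const).measurableSet
  rw [Measure.map_apply hcont.measurable hcl]
  have hset : standardize c d hc ⁻¹' {y | y s = x}
      = (fun m : C(S, ℝ) => m s) ⁻¹' {x * c s + d s} := by
    ext m
    change (m s - d s) / c s = x ↔ m s = x * c s + d s
    rw [div_eq_iff (hc s).ne', sub_eq_iff_eq_add]
  have heval : Measurable fun m : C(S, ℝ) => m s := (continuous_eval_const s).measurable
  rw [hset, ← Measure.map_apply heval (measurableSet_singleton _),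
    AEMeasurable.map_map_of_aemeasurable heval.aemeasurable hU₀.aemeasurable]
  exact (hU₀.margin s).absolutelyContinuous Real.volume_singleton

end Standardize

/-! ### The main theorem -/

theorem mainTheorem1 {S : Type*} [MetricSpace S] [CompactSpace S] [Nonempty S]
    [MeasurableSpace C(S, ℝ)] [BorelSpace C(S, ℝ)]
    {Ω₀ Ω Ω₁ Ω₂ : Type*} [MeasurableSpace Ω₀] [MeasurableSpace Ω]
    [MeasurableSpace Ω₁] [MeasurableSpace Ω₂]
    (P₀ : Measure Ω₀) [IsProbabilityMeasure P₀] (P : Measure Ω) [IsProbabilityMeasure P]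
    (Q : Measure Ω₁) [IsProbabilityMeasure Q] (ρ : Measure Ω₂) [IsProbabilityMeasure ρ]
    (U₀ : Ω₀ → C(S, ℝ)) (U : ℕ → Ω → C(S, ℝ)) (η : Ω₁ → C(S, ℝ)) (Z : Ω₂ → C(S, ℝ))
    (hU₀ : IsCopulaProcess U₀ P₀)
    (hU : IsIIDCopies U P U₀ P₀)
    (hη : IsStandardMaxStableProcess η Q)
    (hdom : InMaxDomainOfAttraction U P η Q)
    (hZ : GeneratesDNormOf Z ρ η Q) :
    (∀ n : ℕ, strictConcurrenceProb U P n = (n + 1 : ℝ) * completeRecordProb U P n) ∧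
    Integrable (fun ω => dualDNorm Z ρ (η ω)) Q ∧
    Tendsto (fun n : ℕ => (n + 1 : ℝ) * completeRecordProb U P n) atTop
      (𝓝 (∫ ω, dualDNorm Z ρ (η ω) ∂Q)) ∧
    Tendsto (fun n : ℕ => sampleConcurrenceProb U P n) atTop
      (𝓝 (∫ ω, dualDNorm Z ρ (η ω) ∂Q)) := by
  obtain ⟨hind, hident⟩ := hU
  have hm : ∀ i, AEMeasurable (U i) P := fun i => (hident i).aemeasurable_fst
  have hlaw : ∀ i, P.map (U i) = P₀.map U₀ := fun i => (hident i).map_eq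
  have hstrict : ∀ n : ℕ,
      strictConcurrenceProb U P n = (n + 1 : ℝ) * completeRecordProb U P n := fun n =>
    hind.measureReal_exists_champion hm hlaw (R := fun f g : C(S, ℝ) => ∀ s, f s < g s)
      measurableSet_forall_lt
      (fun f g h h' => (h (Classical.arbitrary S)).not_gt (h' _)) n
  obtain ⟨c, d, hc, hconv⟩ := hdom
  have hst : ∀ n, Measurable (standardize (c n) (d n) (hc n)) := fun n =>
    (continuous_standardize _ _ _).measurable
  have hY : IsMaxConvergentArray (fun n i ω => standardize (c n) (d n) (hc n) (U i ω)) P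
      (fun n => (P₀.map U₀).map (standardize (c n) (d n) (hc n))) η Q :=
    { indep := fun n => hind.comp (fun _ => standardize (c n) (d n) (hc n)) fun _ => hst n
      aemeasurable := fun n i => (hst n).comp_aemeasurable (hm i)
      map_eq := fun n i => by
        rw [← hlaw i, AEMeasurable.map_map_of_aemeasurable (hst n).aemeasurable (hm i)]
        rfl
      tendsto := hconv }
  have hlim := hY.tendsto_record hη hZ (Classical.arbitrary S) fun n x =>
    hU₀.map_standardize_apply_eq _ _ _ _ x
  -- Standardization preserves pointwise order, so the norming functions disappear from the record
  -- events.
  simp only [maxFirst_apply_lt_iff, maxFirst_apply_le_iff, standardize_lt_standardize_iff,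
    standardize_le_standardize_iff, ← integral_dualDNorm_comp hη hZ] at hlim
  have hrec : Tendsto (fun n : ℕ => (n + 1 : ℝ) * completeRecordProb U P n) atTop
      (𝓝 (∫ ω, dualDNorm Z ρ (η ω) ∂Q)) := by
    refine tendsto_add_one_mul_of_tendsto_succ (hlim.1.congr fun n => ?_)
    congr 2
    ext ω
    exact ⟨fun h i hi s => h s i (Nat.lt_succ_iff.1 hi),
      fun h s i hi => h i (Nat.lt_succ_of_le hi) s⟩
  have hweak : Tendsto (fun n : ℕ => (n + 1 : ℝ) * P.real {ω | ∀ i < n, ∀ s, U i ω s ≤ U n ω s})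
      atTop (𝓝 (∫ ω, dualDNorm Z ρ (η ω) ∂Q)) := by
    refine tendsto_add_one_mul_of_tendsto_succ
      (x := fun n => P.real {ω | ∀ i < n, ∀ s, U i ω s ≤ U n ω s}) (hlim.2.congr fun n => ?_)
    congr 2
    ext ω
    exact ⟨fun h i hi s => h s i (Nat.lt_succ_iff.1 hi),
      fun h s i hi => h i (Nat.lt_succ_of_le hi) s⟩
  refine ⟨hstrict, integrable_dualDNorm_comp hη hZ, hrec,
    tendsto_of_tendsto_of_tendsto_of_le_of_le hrec hweak (fun n => ?_) fun n => ?_⟩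
  · simp only [← hstrict]
    refine measureReal_mono fun ω => ?_
    rintro ⟨k, hk, h⟩
    refine ⟨k, hk, ?_⟩
    ext s
    refine le_antisymm ((maxFirst_apply_le_iff _ _ _ _).2 fun j hj => ?_)
      (le_maxFirst_apply (fun i => U i ω) hk s)
    rcases eq_or_ne j k with rfl | hjk
    · exact le_rfl
    · exact (h j hj hjk s).le
  -- An observation equal to the maximum is a weak champion. With possible ties only the union bound
  -- is available, which is enough here.
  · refine le_trans (measureReal_mono fun ω => ?_)
      (hind.measureReal_exists_champion_le hm hlaw (R := fun f g => ∀ s, f s ≤ g s)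
        measurableSet_forall_le n)
    rintro ⟨k, hk, h⟩
    refine ⟨k, hk, fun j hj _ s => ?_⟩
    rw [← h]
    exact le_maxFirst_apply (fun i => U i ω) hj s
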